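/- Let $\Gamma$ be a metric graph with finitely many vertices and finitely many edges, each of which is either an interval of finite positive length joining two (possibly equal) vertices or a half-line attached to one vertex. Let $B$ be a subset of its vertices (the boundary), $B=\{v_1,\dots,v_{|B|}\}$. For $\mu>0$ let $\Gamma_\mu$ be the graph obtained from $\Gamma$ by multiplying the lengths of all edges by $\mu$ (half-lines are unaffected), and let $H^2(\Gamma_\mu)$ be the space of real functions that are of class $H^2$ on every edge. For $\mathbf p=(p_1,\dots,p_{|B|})\in\mathbb R^{|B|}$ consider the boundary value problem $$ \begin{cases} (-\Delta+1)\Psi=2|\Psi|^2\Psi & \text{on every edge } e\in\Gamma_\mu,\\ \Psi \text{ satisfies the Neumann--Kirchhoff conditions} & \text{at every vertex } v\notin B,\\ \Psi(v_j)=p_j & \text{for every } v_j\in B, \end{cases}\qquad(1) $$ where the Neumann--Kirchhoff conditions at $v$ say that $\Psi$ is continuous at $v$ and the sum of its derivatives at $v$ along the edges at $v$, all directed away from $v$, is zero, and where $\Psi(v_j)=p_j$ says that $\Psi$ takes the value $p_j$ at $v_j$ on every edge ending there. The Neumann data of $\Psi$ are $\mathbf q=(q_1,\dots,q_{|B|})$,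 $q_j=\sum_{e\sim v_j}\partial\Psi_e(v_j)$, where $\partial$ is the derivative at $v_j$ along $e$ in the direction pointing out of the edge. Let $d_j$ be the degree of $v_j$ (a loop counts twice, in $d_j$ as in the sums over edges at a vertex) and let $\ell_{\min}$ be the length of the shortest edge of $\Gamma$ (half-lines have infinite length; $e^{-\mu\ell_{\min}}=0$ if $\ell_{\min}=\infty$). **Theorem.** There are $C_0>0$, $p_0>0$ and $\mu_0>0$ such that for every $\mathbf p$ with $\|\mathbf p\|<p_0$ and every $\mu>\mu_0$ there exists a solution $\Psi\in H^2(\Gamma_\mu)$ of (1) with $|\Psi(z)|<\frac1{\sqrt2}$ for all $z\in\Gamma_\mu$, and it is the unique solution of (1) in $H^2(\Gamma_\mu)$ with this bound. It satisfies $$\|\Psi\|_{H^2(\Gamma_\mu)}\le C_0\|\mathbf p\|,$$ and its Neumann data satisfy $$|q_j-d_jp_j|\le C_0\left(\|\mathbf p\|e^{-\mu\ell_{\min}}+\|\mathbf p\|^3\right),\qquad 1\le j\le|B|.$$ On the set of $(\mathbf p,\mu)$ with $\|\mathbf p\|<p_0$ and $\mu>\mu_0$, the Neumann data $\mathbf q$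 are a $C^1$ function of $(\mathbf p,\mu)$, with $$\left|\frac{\partial q_j}{\partial p_i}-d_j\delta_{ij}\right|\le C_0\left(e^{-\mu\ell_{\min}}+\|\mathbf p\|^2\right),\quad 1\le i,j\le|B|,\qquad \left|\frac{\partial q_j}{\partial\mu}\right|\le C_0\,\mu^{-1}\|\mathbf p\|,\quad 1\le j\le|B|.$$ Furthermore, if $p_j\ge0$ for every $j$, then $\Psi(z)\ge0$ for all $z\in\Gamma_\mu$. -/

import Mathlib

open MeasureTheory

noncomputable section

/-- A metric graph with vertices `V`, edges of finite length `E` and half-lines `H`. The edge `e` is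
the interval `[0, len e]`, whose point `0` is attached to the vertex `src e` and whose point `len e`
is attached to the vertex `tgt e`; a half-line `h` is `[0, ∞)` with `0` attached to `base h`.
Loops and multiple edges are allowed. -/
structure MetricGraph (V E H : Type*) where
  src : E → V
  tgt : E → V
  len : E → ℝ
  len_pos : ∀ e, 0 < len e
  base : H → V

/-- A real function of the Sobolev class `H²(I)` on an interval `I` with left end `0`
(`[0, L]` or `[0, ∞)`): its continuous representative `val`, its continuous derivative `d1` and its
second weak derivative `d2`. That `d1` is the weak derivative of `val` and `d2` the weak derivative
of `d1` is expressed by absolute continuity: `val` and `d1` are the primitives of `d1` and `d2`. -/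
structure H2Fun (I : Set ℝ) where
  val : ℝ → ℝ
  d1 : ℝ → ℝ
  d2 : ℝ → ℝ
  memLp_val : MemLp val 2 (volume.restrict I)
  memLp_d1 : MemLp d1 2 (volume.restrict I)
  memLp_d2 : MemLp d2 2 (volume.restrict I)
  val_eq : ∀ x ∈ I, val x = val 0 + ∫ t in (0 : ℝ)..x, d1 t
  d1_eq : ∀ x ∈ I, d1 x = d1 0 + ∫ t in (0 : ℝ)..x, d2 t

/-- The square of the `H²(I)` norm. -/
def H2Fun.normSq {I : Set ℝ} (f : H2Fun I) : ℝ :=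
  (∫ x in I, f.val x ^ 2) + (∫ x in I, f.d1 x ^ 2) + ∫ x in I, f.d2 x ^ 2

namespace MetricGraph

variable {V E H : Type*}

/-- The interval that is the edge `e` of the scaled graph `Γ_μ`, in which the length of every
edge is multiplied by `μ`; the half-lines are unaffected by the scaling. -/
def edge (Γ : MetricGraph V E H) (μ : ℝ) (e : E) : Set ℝ := Set.Icc 0 (μ * Γ.len e)

/-- The component-wise Sobolev space `H²(Γ_μ)`, without any vertex conditions. -/
structure H2 (Γ : MetricGraph V E H) (μ : ℝ) where
  onEdge : ∀ e, H2Fun (Γ.edge μ e)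
  onRay : H → H2Fun (Set.Ici 0)

/-- The property `P` holds for the value of `Ψ` at every point of `Γ_μ`. -/
def H2.Everywhere {Γ : MetricGraph V E H} {μ : ℝ} (Ψ : Γ.H2 μ) (P : ℝ → Prop) : Prop :=
  (∀ e, ∀ z ∈ Γ.edge μ e, P ((Ψ.onEdge e).val z)) ∧
    ∀ h, ∀ z ∈ Set.Ici (0 : ℝ), P ((Ψ.onRay h).val z)

/-- `Ψ` and `Ψ'` are the same function on `Γ_μ`. -/
def H2.Same {Γ : MetricGraph V E H} {μ : ℝ} (Ψ Ψ' : Γ.H2 μ) : Prop :=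
  (∀ e, ∀ z ∈ Γ.edge μ e, (Ψ.onEdge e).val z = (Ψ'.onEdge e).val z) ∧
    ∀ h, ∀ z ∈ Set.Ici (0 : ℝ), (Ψ.onRay h).val z = (Ψ'.onRay h).val z

/-- The norm of `H²(Γ_μ)`. -/
def H2.norm {Γ : MetricGraph V E H} {μ : ℝ} [Fintype E] [Fintype H] (Ψ : Γ.H2 μ) : ℝ :=
  Real.sqrt (∑ e, (Ψ.onEdge e).normSq + ∑ h, (Ψ.onRay h).normSq)

/-- All edge ends at the vertex `v` carry the same value `c` of `Ψ`: the function `Ψ` is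
continuous at `v`, with `Ψ(v) = c`. -/
def H2.HasValueAt {Γ : MetricGraph V E H} {μ : ℝ} (Ψ : Γ.H2 μ) (v : V) (c : ℝ) : Prop :=
  (∀ e, Γ.src e = v → (Ψ.onEdge e).val 0 = c) ∧
    (∀ e, Γ.tgt e = v → (Ψ.onEdge e).val (μ * Γ.len e) = c) ∧
    ∀ h, Γ.base h = v → (Ψ.onRay h).val 0 = c

/-- The sum, over all edge ends at the vertex `v`, of the derivatives of `Ψ` at `v` along the edge
in the direction that points out of the edge (out of the graph); a loop at `v` contributes two
terms. -/
def H2.flux {Γ : MetricGraph V E H} {μ : ℝ} [Fintype E] [Fintype H] [DecidableEq V]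
    (Ψ : Γ.H2 μ) (v : V) : ℝ :=
  (∑ e with Γ.src e = v, -(Ψ.onEdge e).d1 0) +
    (∑ e with Γ.tgt e = v, (Ψ.onEdge e).d1 (μ * Γ.len e)) +
    ∑ h with Γ.base h = v, -(Ψ.onRay h).d1 0

/-- The Neumann--Kirchhoff conditions at the vertex `v`. -/
def H2.NeumannKirchhoff {Γ : MetricGraph V E H} {μ : ℝ} [Fintype E] [Fintype H] [DecidableEq V]
    (Ψ : Γ.H2 μ) (v : V) : Prop :=
  (∃ c, Ψ.HasValueAt v c) ∧ Ψ.flux v = 0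

/-- `(-Δ + 1) Ψ = 2 |Ψ|² Ψ` on every edge and half-line of `Γ_μ`, as an identity in `L²`. -/
def H2.SolvesNLS {Γ : MetricGraph V E H} {μ : ℝ} (Ψ : Γ.H2 μ) : Prop :=
  (∀ e, ∀ᵐ z ∂volume.restrict (Γ.edge μ e),
      -(Ψ.onEdge e).d2 z + (Ψ.onEdge e).val z
        = 2 * |(Ψ.onEdge e).val z| ^ 2 * (Ψ.onEdge e).val z) ∧
    ∀ h, ∀ᵐ z ∂volume.restrict (Set.Ici (0 : ℝ)),
      -(Ψ.onRay h).d2 z + (Ψ.onRay h).val z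
        = 2 * |(Ψ.onRay h).val z| ^ 2 * (Ψ.onRay h).val z

/-- `Ψ` solves the nonlinear boundary value problem on `Γ_μ` with boundary `B` and Dirichlet
data `p`. -/
def H2.SolvesBVP {Γ : MetricGraph V E H} {μ : ℝ} [Fintype E] [Fintype H] [DecidableEq V]
    (Ψ : Γ.H2 μ) (B : Finset V) (p : EuclideanSpace ℝ B) : Prop :=
  Ψ.SolvesNLS ∧ (∀ v, v ∉ B → Ψ.NeumannKirchhoff v) ∧ ∀ j : B, Ψ.HasValueAt j (p j)

/-- The Neumann data of `Ψ` on `B`. -/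
def H2.neumann {Γ : MetricGraph V E H} {μ : ℝ} [Fintype E] [Fintype H] [DecidableEq V]
    (Ψ : Γ.H2 μ) (B : Finset V) : B → ℝ :=
  fun j => Ψ.flux j

/-- The degree of the vertex `v`; a loop at `v` is counted twice. -/
def degree (Γ : MetricGraph V E H) [Fintype E] [Fintype H] [DecidableEq V] (v : V) : ℕ :=
  (Finset.univ.filter fun e => Γ.src e = v).card +
    (Finset.univ.filter fun e => Γ.tgt e = v).card +
    (Finset.univ.filter fun h => Γ.base h = v).card

open Classical in
/-- The number `exp (-μ ℓ_min)`, where `ℓ_min` is the length of the shortest edge of `Γ`. Half-lines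
have infinite length, so if there is no edge of finite length then `ℓ_min = ∞` and the number
is `0`. -/
def expMinLen (Γ : MetricGraph V E H) (μ : ℝ) : ℝ :=
  if Nonempty E then Real.exp (-(μ * ⨅ e, Γ.len e)) else 0

end MetricGraph

end

/-!
On an edge of length `L` a solution of `-ψ'' + ψ = 2 ψ³` is the sum of two waves `u = (ψ + ψ') / 2`
and `v = (ψ - ψ') / 2`, with `u' = u - ψ³` and `v' = -v + ψ³`. Prescribe the waves that leave the
two ends, `v(0) = α` and `u(L) = β`. After rescaling to `[0, 1]` the solution is the fixed point of
`ψ(t) = α exp (-L t) + β exp (-L (1 - t)) + ∫₀¹ L exp (-L |t - s|) ψ(s)³ ds`, a contraction of a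
small ball of `C([0, 1])` whose constant does not depend on `L`. The uniform contraction principle
(`exists_contDiffOn_fixedPoint`, from the implicit function theorem) makes the fixed point `edgeSol`
a `C¹` function of `(α, β, L)`, and differentiation of the equation gives
`abs_fderiv_edgeSol_sub_le`. So the waves that arrive at the ends, `incLeft = u(0)` and
`incRight = v(L)`, have derivatives of size `exp (-L) + (|α| + |β|)²` in `α` and `β`, and of size
`(|α| + |β|) / L` in `L`. The predicate `IsSmall` records such bounds. On a half-line the solutions
are translates of `± sech`, and minus the derivative at the end is `c √(1 - c²)`, where `c` is the
value there.

The vertex values and the outgoing waves on all edges are the unknowns of a finite system. At an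
edge end, value = outgoing wave + incoming wave, and flux = value - 2 (incoming wave); the flux of
the solution at `v` is therefore `(degree v) Ψ(v)` minus the small function `fluxDefect v`. The
Kirchhoff condition at a vertex outside `B` gives its value as a small function of the unknowns, so
the system is `y = (linear function of p) + (small function of μ, y)`. It is solved by a second use
of the uniform contraction principle (`exists_solution_of_isSmall`). The estimates of the Neumann
data `d_j p_j - fluxDefect j` and of their derivatives are then the bounds in `IsSmall` along the
solution (`IsSmall.comp_solution`).

Uniqueness and positivity rest on monotone quantities. For a solution with `|Ψ| < 1 / √2`, the
product `((σ Ψ - M)₊)² σ Ψ'` has a nonnegative derivative on every edge, and its net flux through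
the graph vanishes if `σ p_j ≤ M` for all `j`. Hence `σ Ψ ≤ M` (`le_of_boundary_le`): with `σ = ± 1`
and `M = ‖p‖` every solution is small, and with `σ = -1` and `M = 0` it is nonnegative for
nonnegative `p`. For two small solutions `Ψ`, `Φ` the same argument with `(Ψ - Φ) (Ψ - Φ)'` shows
that they coincide (`same_of_small`).
-/

/-! ### Fixed points that depend on a parameter -/

noncomputable section

open Metric Set Filter Topology in
/-- **Uniform contraction principle.** The fixed point of a `C¹` family of contractions, with a
common contraction constant, is a `C¹` function of the parameter. -/
theorem exists_contDiffOn_fixedPoint {P X : Type*}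
    [NormedAddCommGroup P] [NormedSpace ℝ P] [CompleteSpace P]
    [NormedAddCommGroup X] [NormedSpace ℝ X] [CompleteSpace X]
    {U : Set P} (hU : IsOpen U) {r : ℝ} {T : P × X → X}
    (hT : ContDiffOn ℝ 1 T (U ×ˢ ball 0 r))
    (hlip : ∀ p ∈ U, ∀ x ∈ ball (0 : X) r, ∀ y ∈ ball (0 : X) r,
      ‖T (p, x) - T (p, y)‖ ≤ 1 / 2 * ‖x - y‖)
    (h0 : ∀ p ∈ U, ‖T (p, 0)‖ < r / 2) :
    ∃ x : P → X, ContDiffOn ℝ 1 x U ∧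
      ∀ p ∈ U, T (p, x p) = x p ∧ ‖x p‖ ≤ 2 * ‖T (p, 0)‖ := by
  have hopen : IsOpen (U ×ˢ ball (0 : X) r) := hU.prod isOpen_ball
  have hex : ∀ p : P, ∃ x : X, p ∈ U → T (p, x) = x ∧ ‖x‖ ≤ 2 * ‖T (p, 0)‖ := by
    intro p
    by_cases hp : p ∈ U
    swap
    · exact ⟨0, fun h => absurd h hp⟩
    have hr := h0 p hp
    have hn := norm_nonneg (T (p, 0))
    have hsub : closedBall (0 : X) (2 * ‖T (p, 0)‖) ⊆ ball 0 r :=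
      closedBall_subset_ball (by linarith)
    have hmaps : MapsTo (fun x => T (p, x)) (closedBall (0 : X) (2 * ‖T (p, 0)‖))
        (closedBall (0 : X) (2 * ‖T (p, 0)‖)) := by
      intro x hx
      have h1 := hlip p hp x (hsub hx) 0 (mem_ball_self (by linarith))
      rw [mem_closedBall_zero_iff] at hx ⊢
      have h2 := norm_le_norm_sub_add (T (p, x)) (T (p, 0))
      rw [sub_zero] at h1
      linarith
    have hc : ContractingWith (1 / 2 : NNReal) (hmaps.restrict _ _ _) := by
      refine ⟨by rw [← NNReal.coe_lt_coe]; norm_num, LipschitzWith.of_dist_le_mul ?_⟩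
      intro x y
      have := hlip p hp x (hsub x.2) y (hsub y.2)
      simpa [Subtype.dist_eq, dist_eq_norm] using this
    obtain ⟨y, hy, hfix, -⟩ := hc.exists_fixedPoint' isClosed_closedBall.isComplete hmaps
      (x := 0) (mem_closedBall_self (by linarith)) (edist_ne_top _ _)
    exact ⟨y, fun _ => ⟨hfix, by simpa using hy⟩⟩
  choose x hx using hex
  refine ⟨x, ?_, hx⟩
  have hmem : ∀ p ∈ U, x p ∈ ball (0 : X) r := fun p hp => by
    have := (hx p hp).2
    have := h0 p hp
    rw [mem_ball_zero_iff]; linarith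
  have hcont : ∀ p ∈ U, ContinuousAt x p := by
    intro p hp
    have hTc : ContinuousAt (fun q => T (q, x p)) p := by
      have : ContinuousAt T (p, x p) := (hT.contDiffAt (hopen.mem_nhds ⟨hp, hmem p hp⟩)).continuousAt
      exact this.comp (f := fun q => (q, x p)) (by fun_prop)
    rw [ContinuousAt, tendsto_iff_norm_sub_tendsto_zero] at hTc ⊢
    have h2 : Tendsto (fun q => 2 * ‖T (q, x p) - T (p, x p)‖) (𝓝 p) (𝓝 0) := by
      simpa using hTc.const_mul 2
    refine squeeze_zero' (Eventually.of_forall fun _ => norm_nonneg _) ?_ h2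
    filter_upwards [hU.mem_nhds hp] with q hq
    have h3 := hlip q hq _ (hmem q hq) _ (hmem p hp)
    rw [(hx q hq).1] at h3
    rw [(hx p hp).1]
    have h4 := norm_sub_le_norm_sub_add_norm_sub (x q) (T (q, x p)) (x p)
    linarith
  intro p hp
  apply ContDiffAt.contDiffWithinAt
  have hu := hT.contDiffAt (hopen.mem_nhds (x := (p, x p)) ⟨hp, hmem p hp⟩)
  set F : P × X → X := fun z => z.2 - T z with hF
  have hFu : ContDiffAt ℝ 1 F (p, x p) := contDiffAt_snd.sub hu
  have hTd : HasFDerivAt T (fderiv ℝ T (p, x p)) (p, x p) :=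
    (hu.differentiableAt one_ne_zero).hasFDerivAt
  have hnorm : ‖fderiv ℝ T (p, x p) ∘L .inr ℝ P X‖ ≤ 1 / 2 := by
    have hg : HasFDerivAt (fun y => T (p, y)) (fderiv ℝ T (p, x p) ∘L .inr ℝ P X) (x p) :=
      hTd.comp (x p) (hasFDerivAt_prodMk_right p (x p))
    refine hg.le_of_lip' (by norm_num) ?_
    filter_upwards [isOpen_ball.mem_nhds (hmem p hp)] with y hy
    exact hlip p hp y hy _ (hmem p hp)
  have hinv : (fderiv ℝ F (p, x p) ∘L .inr ℝ P X).IsInvertible := by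
    have h1 : fderiv ℝ F (p, x p) = .snd ℝ P X - fderiv ℝ T (p, x p) :=
      (hasFDerivAt_snd.sub hTd).fderiv
    have h2 : fderiv ℝ F (p, x p) ∘L .inr ℝ P X
        = 1 - fderiv ℝ T (p, x p) ∘L .inr ℝ P X := by
      rw [h1]; ext y; simp
    rw [h2]
    have hlt : ‖fderiv ℝ T (p, x p) ∘L .inr ℝ P X‖ < 1 := by linarith
    refine ⟨ContinuousLinearEquiv.ofUnit (Units.oneSub _ hlt), ?_⟩
    rfl
  have hev := hFu.eventually_apply_eq_iff_implicitFunction one_ne_zero hinv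
  have htend : Tendsto (fun q => (q, x q)) (𝓝 p) (𝓝 (p, x p)) :=
    (continuousAt_id.prodMk (hcont p hp))
  refine (hFu.contDiffAt_implicitFunction one_ne_zero hinv).congr_of_eventuallyEq ?_
  filter_upwards [htend.eventually hev, hU.mem_nhds hp] with q hq hqU
  refine (hq.1 ?_).symm
  simp [hF, (hx q hqU).1, (hx p hp).1]

/-- The equation for the derivative of a fixed point that depends on a parameter: differentiate
`T (p, x p) = x p`. -/
theorem fderiv_fixedPoint {P X : Type*}
    [NormedAddCommGroup P] [NormedSpace ℝ P] [NormedAddCommGroup X] [NormedSpace ℝ X]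
    {U : Set P} (hU : IsOpen U) {T : P × X → X} {x : P → X}
    (hx : ∀ p ∈ U, T (p, x p) = x p) {p : P} (hp : p ∈ U)
    (hT : DifferentiableAt ℝ T (p, x p)) (hxd : DifferentiableAt ℝ x p) (p' : P) :
    fderiv ℝ T (p, x p) (p', fderiv ℝ x p p') = fderiv ℝ x p p' := by
  have h1 : HasFDerivAt (fun q => T (q, x q))
      (fderiv ℝ T (p, x p) ∘L (ContinuousLinearMap.id ℝ P).prod (fderiv ℝ x p)) p :=
    hT.hasFDerivAt.comp p ((hasFDerivAt_id p).prodMk hxd.hasFDerivAt)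
  have h2 : HasFDerivAt (fun q => T (q, x q)) (fderiv ℝ x p) p :=
    hxd.hasFDerivAt.congr_of_eventuallyEq <| by
      filter_upwards [hU.mem_nhds hp] with q hq using hx q hq
  have := h1.unique h2
  simpa using congrArg (fun A => A p') this
end

/-! ### Exponential kernels on the unit interval -/

noncomputable section

open unitInterval Filter Topology

/-- The family `L ↦ exp (-L d)` of continuous functions on a compact space. -/
def expFam {X : Type*} [TopologicalSpace X] (d : C(X, ℝ)) (L : ℝ) : C(X, ℝ) :=
  ⟨fun x => Real.exp (-(L * d x)), by fun_prop⟩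

@[simp] theorem expFam_apply {X : Type*} [TopologicalSpace X] (d : C(X, ℝ)) (L : ℝ) (x : X) :
    expFam d L x = Real.exp (-(L * d x)) := rfl

section expFam

variable {X : Type*} [TopologicalSpace X] [CompactSpace X] (d : C(X, ℝ))

theorem hasDerivAt_expFam (L : ℝ) : HasDerivAt (expFam d) (-(d * expFam d L)) L := by
  -- in the Banach algebra `C(X, ℝ)` the family is `L ↦ exp (L • (-d))`
  have h : ∀ L : ℝ, NormedSpace.exp (L • (-d)) = expFam d L := by
    intro L
    ext x
    have := NormedSpace.map_exp (ContinuousMap.evalAlgHom ℝ ℝ x : C(X, ℝ) →ₐ[ℝ] ℝ)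
      (continuous_eval_const x) (L • (-d))
    simp only [ContinuousMap.evalAlgHom_apply] at this
    rw [this, ← Real.exp_eq_exp_ℝ]
    simp
  have h2 := hasDerivAt_exp_smul_const (𝕂 := ℝ) (-d) L
  rw [h] at h2
  exact (h2.congr_of_eventuallyEq (Eventually.of_forall fun u => (h u).symm)).congr_deriv
    (by rw [mul_neg, mul_comm])

theorem contDiff_expFam : ContDiff ℝ 1 (expFam d) := by
  rw [contDiff_one_iff_deriv]
  have hd : Differentiable ℝ (expFam d) := fun L => (hasDerivAt_expFam d L).differentiableAt
  refine ⟨hd, ?_⟩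
  have : deriv (expFam d) = fun L => -(d * expFam d L) :=
    funext fun L => (hasDerivAt_expFam d L).deriv
  rw [this]
  exact (continuous_const.mul hd.continuous).neg

variable {d}

theorem norm_expFam_le (hd : ∀ x, 0 ≤ d x) {L : ℝ} (hL : 0 < L) : ‖expFam d L‖ ≤ 1 := by
  rw [ContinuousMap.norm_le _ zero_le_one]
  intro x
  rw [expFam_apply, Real.norm_eq_abs, abs_of_pos (Real.exp_pos _), Real.exp_le_one_iff]
  have := mul_nonneg hL.le (hd x)
  linarith

theorem norm_mul_expFam_le (hd : ∀ x, 0 ≤ d x) {L : ℝ} (hL : 0 < L) : ‖d * expFam d L‖ ≤ L⁻¹ := by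
  rw [ContinuousMap.norm_le _ (inv_nonneg.2 hL.le)]
  intro x
  have h0 := hd x
  rw [ContinuousMap.mul_apply, expFam_apply, Real.norm_eq_abs,
    abs_of_nonneg (mul_nonneg h0 (Real.exp_pos _).le), Real.exp_neg,
    ← div_eq_mul_inv, div_le_iff₀ (Real.exp_pos _), inv_mul_eq_div, le_div_iff₀ hL]
  have := Real.add_one_le_exp (L * d x)
  nlinarith

end expFam

/-- The integral operator on `C(I, ℝ)`, `I = [0, 1]`, with a continuous kernel, as a continuous
bilinear map in the kernel and the function. -/
def kernelOp : C(I × I, ℝ) →L[ℝ] C(I, ℝ) →L[ℝ] C(I, ℝ) :=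
  LinearMap.mkContinuous₂
    (LinearMap.mk₂ ℝ
      (fun k f => (⟨fun t => ∫ s : I, k (t, s) * f s,
        continuous_of_dominated (bound := fun _ => ‖k‖ * ‖f‖)
          (fun t => by
            have : Continuous fun s : I => k (t, s) * f s := by fun_prop
            exact this.aestronglyMeasurable)
          (fun t => Eventually.of_forall fun s => by
            rw [norm_mul]
            exact mul_le_mul (k.norm_coe_le_norm _) (f.norm_coe_le_norm _) (norm_nonneg _)
              (norm_nonneg _))
          (integrable_const _)
          (Eventually.of_forall fun s => by fun_prop)⟩ : C(I, ℝ)))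
      (fun k k' f => by
        ext t
        simp only [ContinuousMap.coe_mk, ContinuousMap.add_apply, add_mul]
        exact integral_add
          ((by fun_prop : Continuous fun s : I => k (t, s) * f s).integrable_of_hasCompactSupport
            (HasCompactSupport.of_compactSpace _))
          ((by fun_prop : Continuous fun s : I => k' (t, s) * f s).integrable_of_hasCompactSupport
            (HasCompactSupport.of_compactSpace _)))
      (fun c k f => by
        ext t
        simp [mul_assoc, integral_const_mul])
      (fun k f f' => by
        ext t
        simp only [ContinuousMap.coe_mk, ContinuousMap.add_apply, mul_add]
        exact integral_add
          ((by fun_prop : Continuous fun s : I => k (t, s) * f s).integrable_of_hasCompactSupport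
            (HasCompactSupport.of_compactSpace _))
          ((by fun_prop : Continuous fun s : I => k (t, s) * f' s).integrable_of_hasCompactSupport
            (HasCompactSupport.of_compactSpace _)))
      (fun c k f => by
        ext t
        simp [mul_left_comm, integral_const_mul]))
    1
    (fun k f => by
      rw [one_mul, ContinuousMap.norm_le _ (by positivity)]
      intro t
      refine (norm_integral_le_of_norm_le_const (C := ‖k‖ * ‖f‖)
        (Eventually.of_forall fun s => ?_)).trans (by simp)
      rw [norm_mul]
      exact mul_le_mul (k.norm_coe_le_norm _) (f.norm_coe_le_norm _) (norm_nonneg _)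
        (norm_nonneg _))

@[simp] theorem kernelOp_apply (k : C(I × I, ℝ)) (f : C(I, ℝ)) (t : I) :
    kernelOp k f t = ∫ s : I, k (t, s) * f s := rfl

theorem integral_unitInterval_eq (g : ℝ → ℝ) : ∫ s : I, g s = ∫ s in (0 : ℝ)..1, g s := by
  rw [intervalIntegral.integral_of_le zero_le_one, ← integral_Icc_eq_integral_Ioc]
  exact unitInterval.measurePreserving_coe.integral_comp unitInterval.measurableEmbedding_coe g

theorem integral_exp_neg_abs_sub_le {m : ℝ} (hm : 0 < m) {t : ℝ} (ht : t ∈ Set.Icc (0 : ℝ) 1) :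
    ∫ s in (0 : ℝ)..1, Real.exp (-(m * |t - s|)) ≤ 2 / m := by
  have hc : Continuous fun s : ℝ => Real.exp (-(m * |t - s|)) := by fun_prop
  rw [← intervalIntegral.integral_add_adjacent_intervals (hc.intervalIntegrable 0 t)
    (hc.intervalIntegrable t 1)]
  have h1 : ∫ s in (0 : ℝ)..t, Real.exp (-(m * |t - s|)) ≤ 1 / m := by
    have : ∫ s in (0 : ℝ)..t, Real.exp (-(m * |t - s|))
        = Real.exp (-(m * (t - t))) / m - Real.exp (-(m * (t - 0))) / m := by
      refine intervalIntegral.integral_eq_sub_of_hasDerivAt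
        (f := fun s => Real.exp (-(m * (t - s))) / m) (fun s hs => ?_)
        (hc.intervalIntegrable 0 t)
      rw [Set.uIcc_of_le ht.1] at hs
      rw [abs_of_nonneg (by linarith [hs.2])]
      refine (((((hasDerivAt_id' s).const_sub t).const_mul m).fun_neg.exp).div_const m).congr_deriv ?_
      field_simp
    rw [this]
    have := div_pos (Real.exp_pos (-(m * (t - 0)))) hm
    simp only [sub_self, mul_zero, neg_zero, Real.exp_zero]
    linarith
  have h2 : ∫ s in t..1, Real.exp (-(m * |t - s|)) ≤ 1 / m := by
    have : ∫ s in t..1, Real.exp (-(m * |t - s|))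
        = -(Real.exp (-(m * (1 - t))) / m) - -(Real.exp (-(m * (t - t))) / m) := by
      refine intervalIntegral.integral_eq_sub_of_hasDerivAt
        (f := fun s => -(Real.exp (-(m * (s - t))) / m)) (fun s hs => ?_)
        (hc.intervalIntegrable t 1)
      rw [Set.uIcc_of_le ht.2] at hs
      rw [abs_of_nonpos (by linarith [hs.1])]
      refine ((((((hasDerivAt_id' s).sub_const t).const_mul m).fun_neg.exp).div_const
        m).fun_neg).congr_deriv ?_
      rw [neg_sub]
      field_simp
    rw [this]
    have := div_pos (Real.exp_pos (-(m * (1 - t)))) hm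
    simp only [sub_self, mul_zero, neg_zero, Real.exp_zero]
    linarith
  have : 2 / m = 1 / m + 1 / m := by ring
  linarith

/-- The function `(t, s) ↦ |t - s|` on the unit square. -/
def distFun : C(I × I, ℝ) := ⟨fun x => |(x.1 : ℝ) - x.2|, by fun_prop⟩

@[simp] theorem distFun_apply (t s : I) : distFun (t, s) = |(t : ℝ) - s| := rfl

theorem norm_kernelOp_le {k : C(I × I, ℝ)} {A m : ℝ} (hA : 0 ≤ A) (hm : 0 < m)
    (hk : ∀ t s : I, |k (t, s)| ≤ A * Real.exp (-(m * |(t : ℝ) - s|))) (f : C(I, ℝ)) :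
    ‖kernelOp k f‖ ≤ 2 * A / m * ‖f‖ := by
  rw [ContinuousMap.norm_le _ (by positivity)]
  intro t
  rw [kernelOp_apply]
  calc ‖∫ s : I, k (t, s) * f s‖
      ≤ ∫ s : I, ‖f‖ * A * Real.exp (-(m * |(t : ℝ) - s|)) := by
        refine norm_integral_le_of_norm_le ?_ (Eventually.of_forall fun s => ?_)
        · exact (by fun_prop : Continuous fun s : I =>
            ‖f‖ * A * Real.exp (-(m * |(t : ℝ) - s|))).integrable_of_hasCompactSupport
            (HasCompactSupport.of_compactSpace _)
        · rw [norm_mul, mul_comm, mul_assoc]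
          exact mul_le_mul (f.norm_coe_le_norm _) (hk t s) (norm_nonneg _) (norm_nonneg _)
    _ = ‖f‖ * A * ∫ s in (0 : ℝ)..1, Real.exp (-(m * |(t : ℝ) - s|)) := by
        rw [integral_unitInterval_eq (fun s => ‖f‖ * A * Real.exp (-(m * |(t : ℝ) - s|))),
          intervalIntegral.integral_const_mul]
    _ ≤ ‖f‖ * A * (2 / m) :=
        mul_le_mul_of_nonneg_left (integral_exp_neg_abs_sub_le hm t.2) (by positivity)
    _ = 2 * A / m * ‖f‖ := by ring

/-- The coordinate function on `[0, 1]`, that is the distance to the left end. -/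
def leftDist : C(I, ℝ) := ⟨fun t => t, by fun_prop⟩

/-- The distance to the right end of `[0, 1]`. -/
def rightDist : C(I, ℝ) := ⟨fun t => 1 - t, by fun_prop⟩

@[simp] theorem leftDist_apply (t : I) : leftDist t = t := rfl
@[simp] theorem rightDist_apply (t : I) : rightDist t = 1 - t := rfl

theorem leftDist_nonneg (t : I) : 0 ≤ leftDist t := t.2.1
theorem rightDist_nonneg (t : I) : 0 ≤ rightDist t := sub_nonneg.2 t.2.2

/-- The kernel `L exp (-L |t - s|)`; it is twice the Green function of `-L⁻² d²/dt² + 1`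
on the line. -/
def greenKernel (L : ℝ) : C(I × I, ℝ) := L • expFam distFun L

/-- The derivative of `greenKernel` in `L`. -/
def greenKernelDeriv (L : ℝ) : C(I × I, ℝ) :=
  L • (-(distFun * expFam distFun L)) + (1 : ℝ) • expFam distFun L

theorem hasDerivAt_greenKernel (L : ℝ) :
    HasDerivAt greenKernel (greenKernelDeriv L) L :=
  (hasDerivAt_id L).smul (hasDerivAt_expFam distFun L)

theorem contDiff_greenKernel : ContDiff ℝ 1 greenKernel :=
  contDiff_id.smul (contDiff_expFam distFun)

theorem norm_kernelOp_greenKernel_le {L : ℝ} (hL : 0 < L) (f : C(I, ℝ)) :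
    ‖kernelOp (greenKernel L) f‖ ≤ 2 * ‖f‖ := by
  have := norm_kernelOp_le (k := greenKernel L) hL.le hL (fun t s => by
    simp [greenKernel, abs_mul, abs_of_pos hL]) f
  rwa [mul_div_assoc, div_self hL.ne', mul_one] at this

theorem norm_kernelOp_greenKernelDeriv_le {L : ℝ} (hL : 0 < L) (f : C(I, ℝ)) :
    ‖kernelOp (greenKernelDeriv L) f‖ ≤ 8 / L * ‖f‖ := by
  have := norm_kernelOp_le (k := greenKernelDeriv L) (A := 2) (m := L / 2) (by norm_num)
    (by positivity) (fun t s => by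
    simp only [greenKernelDeriv, ContinuousMap.add_apply, ContinuousMap.smul_apply,
      ContinuousMap.neg_apply, ContinuousMap.mul_apply, expFam_apply, distFun_apply, smul_eq_mul]
    set x := L * |(t : ℝ) - s| with hx
    have hx0 : 0 ≤ x := by positivity
    have e1 : L * -(|(t : ℝ) - s| * Real.exp (-x)) + 1 * Real.exp (-x)
        = (1 - x) * Real.exp (-x) := by rw [hx]; ring
    have e2 : L / 2 * |(t : ℝ) - s| = x / 2 := by rw [hx]; ring
    rw [e1, e2, abs_mul, abs_of_pos (Real.exp_pos (-x))]
    -- `1 + x ≤ 2 exp (x / 2)`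
    have h1 : |1 - x| ≤ 2 * Real.exp (x / 2) := by
      have := Real.add_one_le_exp (x / 2)
      rw [abs_le]; constructor <;> linarith
    calc |1 - x| * Real.exp (-x) ≤ 2 * Real.exp (x / 2) * Real.exp (-x) :=
          mul_le_mul_of_nonneg_right h1 (Real.exp_pos _).le
      _ = 2 * Real.exp (-(x / 2)) := by
          rw [mul_assoc, ← Real.exp_add]; ring_nf) f
  convert this using 2
  field_simp
  norm_num

end

/-! ### The integral equation on an edge -/

noncomputable section

open unitInterval Filter Topology

/-- The right-hand side of the integral equation
`ψ(t) = α exp (-L t) + β exp (-L (1 - t)) + ∫₀¹ L exp (-L |t - s|) ψ(s)³ ds` for the solutions of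
`-L⁻² ψ'' + ψ = 2 ψ³` on `[0, 1]`; the parameters are `(α, β, L)`. -/
def edgeMap (x : (ℝ × ℝ × ℝ) × C(I, ℝ)) : C(I, ℝ) :=
  x.1.1 • expFam leftDist x.1.2.2 + x.1.2.1 • expFam rightDist x.1.2.2
    + kernelOp (greenKernel x.1.2.2) (x.2 ^ 3)

theorem contDiff_edgeMap : ContDiff ℝ 1 edgeMap := by
  have h1 := contDiff_expFam leftDist
  have h2 := contDiff_expFam rightDist
  have h3 := contDiff_greenKernel
  have h4 : ContDiff ℝ 1 (fun k : C(I × I, ℝ) => kernelOp k) := by fun_prop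
  unfold edgeMap
  refine ContDiff.add (ContDiff.add ?_ ?_) ?_
  · exact (by fun_prop : ContDiff ℝ 1 fun x : (ℝ × ℝ × ℝ) × C(I, ℝ) => x.1.1).smul
      (h1.comp (by fun_prop))
  · exact (by fun_prop : ContDiff ℝ 1 fun x : (ℝ × ℝ × ℝ) × C(I, ℝ) => x.1.2.1).smul
      (h2.comp (by fun_prop))
  · exact (h4.comp (h3.comp (by fun_prop))).clm_apply (by fun_prop)

theorem hasDerivAt_bilinear {E F G : Type*} [NormedAddCommGroup E] [NormedSpace ℝ E]
    [NormedAddCommGroup F] [NormedSpace ℝ F] [NormedAddCommGroup G] [NormedSpace ℝ G]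
    (B : E →L[ℝ] F →L[ℝ] G) {u : ℝ → E} {v : ℝ → F} {u' : E} {v' : F} {x : ℝ}
    (hu : HasDerivAt u u' x) (hv : HasDerivAt v v' x) :
    HasDerivAt (fun τ => B (u τ) (v τ)) (B u' (v x) + B (u x) v') x :=
  (B.hasFDerivAt.comp_hasDerivAt x hu).clm_apply hv

theorem fderiv_edgeMap (α β L : ℝ) (ψ : C(I, ℝ)) (α' β' L' : ℝ) (ψ' : C(I, ℝ)) :
    fderiv ℝ edgeMap ((α, β, L), ψ) ((α', β', L'), ψ') =
      α' • expFam leftDist L + β' • expFam rightDist L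
        + L' • (α • -(leftDist * expFam leftDist L) + β • -(rightDist * expFam rightDist L)
          + kernelOp (greenKernelDeriv L) (ψ ^ 3))
        + kernelOp (greenKernel L) (3 * ψ ^ 2 * ψ') := by
  -- differentiate along the line through the point in the given direction
  have hlin : ∀ a a' : ℝ, HasDerivAt (fun τ : ℝ => a + τ * a') a' 0 := fun a a' => by
    simpa using ((hasDerivAt_id' (0 : ℝ)).mul_const a').const_add a
  have hψ : HasDerivAt (fun τ : ℝ => ψ + τ • ψ') ψ' 0 := by
    simpa using ((hasDerivAt_id' (0 : ℝ)).smul_const ψ').const_add ψ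
  have hγ : HasDerivAt (fun τ : ℝ => ((α + τ * α', β + τ * β', L + τ * L'), ψ + τ • ψ'))
      ((α', β', L'), ψ') 0 :=
    ((hlin α α').prodMk ((hlin β β').prodMk (hlin L L'))).prodMk hψ
  have h0 : ((α + (0 : ℝ) * α', β + (0 : ℝ) * β', L + (0 : ℝ) * L'), ψ + (0 : ℝ) • ψ')
      = ((α, β, L), ψ) := by simp
  have hT : HasFDerivAt edgeMap (fderiv ℝ edgeMap ((α, β, L), ψ))
      ((α + (0 : ℝ) * α', β + (0 : ℝ) * β', L + (0 : ℝ) * L'), ψ + (0 : ℝ) • ψ') := by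
    rw [h0]
    exact (contDiff_edgeMap.differentiable one_ne_zero _).hasFDerivAt
  have hA := hT.comp_hasDerivAt (0 : ℝ) hγ
  have hL0 : L + (0 : ℝ) * L' = L := by simp
  have hcomp : ∀ {Y : Type} [NormedAddCommGroup Y] [NormedSpace ℝ Y] {g : ℝ → Y} {g' : Y},
      HasDerivAt g g' L → HasDerivAt (fun τ : ℝ => g (L + τ * L')) (L' • g') 0 := by
    intro Y _ _ g g' hg
    rw [← hL0] at hg
    exact hg.scomp (0 : ℝ) (hlin L L')
  have e1 := (hlin α α').smul (hcomp (hasDerivAt_expFam leftDist L))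
  have e2 := (hlin β β').smul (hcomp (hasDerivAt_expFam rightDist L))
  have e3 := hcomp (hasDerivAt_greenKernel L)
  have e5 := hasDerivAt_bilinear (G := C(I, ℝ)) kernelOp e3 (hψ.fun_pow 3)
  have hB := (e1.add e2).add e5
  refine (hA.unique hB).trans ?_
  simp only [zero_mul, zero_smul, add_zero, map_smul, Nat.cast_ofNat, smul_add,
    smul_comm L', smul_apply, Nat.add_one_sub_one]
  abel

theorem norm_edgeMap_zero_le {L : ℝ} (hL : 0 < L) (α β : ℝ) :
    ‖edgeMap ((α, β, L), 0)‖ ≤ |α| + |β| := by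
  have h1 := norm_expFam_le leftDist_nonneg hL
  have h2 := norm_expFam_le rightDist_nonneg hL
  simp only [edgeMap, ne_eq, OfNat.ofNat_ne_zero, not_false_eq_true, zero_pow, map_zero, add_zero]
  refine (norm_add_le _ _).trans ?_
  rw [norm_smul, norm_smul, Real.norm_eq_abs, Real.norm_eq_abs]
  exact add_le_add (mul_le_of_le_one_right (abs_nonneg _) h1)
    (mul_le_of_le_one_right (abs_nonneg _) h2)

theorem norm_edgeMap_sub_le {z : ℝ × ℝ × ℝ} (hL : 0 < z.2.2) {ψ φ : C(I, ℝ)}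
    (hψ : ‖ψ‖ ≤ 1 / 4) (hφ : ‖φ‖ ≤ 1 / 4) :
    ‖edgeMap (z, ψ) - edgeMap (z, φ)‖ ≤ 1 / 2 * ‖ψ - φ‖ := by
  have h1 : edgeMap (z, ψ) - edgeMap (z, φ)
      = kernelOp (greenKernel z.2.2) (ψ ^ 3 - φ ^ 3) := by
    simp only [edgeMap, map_sub]; abel
  have h2 : ψ ^ 3 - φ ^ 3 = (ψ ^ 2 + ψ * φ + φ ^ 2) * (ψ - φ) := by ring
  have h3 : ‖ψ ^ 2 + ψ * φ + φ ^ 2‖ ≤ 3 / 16 := by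
    have a1 : ‖ψ ^ 2‖ ≤ ‖ψ‖ ^ 2 := norm_pow_le _ _
    have a2 : ‖φ ^ 2‖ ≤ ‖φ‖ ^ 2 := norm_pow_le _ _
    have a3 : ‖ψ * φ‖ ≤ ‖ψ‖ * ‖φ‖ := norm_mul_le _ _
    have a4 := norm_add₃_le (a := ψ ^ 2) (b := ψ * φ) (c := φ ^ 2)
    have := norm_nonneg ψ
    have := norm_nonneg φ
    nlinarith
  rw [h1, h2]
  refine (norm_kernelOp_greenKernel_le hL _).trans ?_
  have h4 := norm_mul_le (ψ ^ 2 + ψ * φ + φ ^ 2) (ψ - φ)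
  have := norm_nonneg (ψ - φ)
  nlinarith

/-- The parameters `(α, β, L)` for which the integral equation is solved. -/
def edgeDomain : Set (ℝ × ℝ × ℝ) :=
  {z | |z.1| < 1 / 16 ∧ |z.2.1| < 1 / 16 ∧ 0 < z.2.2}

theorem isOpen_edgeDomain : IsOpen edgeDomain := by
  have h1 : IsOpen {z : ℝ × ℝ × ℝ | |z.1| < 1 / 16} := isOpen_lt (by fun_prop) (by fun_prop)
  have h2 : IsOpen {z : ℝ × ℝ × ℝ | |z.2.1| < 1 / 16} := isOpen_lt (by fun_prop) (by fun_prop)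
  have h3 : IsOpen {z : ℝ × ℝ × ℝ | 0 < z.2.2} := isOpen_lt (by fun_prop) (by fun_prop)
  exact h1.inter (h2.inter h3)

theorem exists_edgeSol : ∃ ψ : ℝ × ℝ × ℝ → C(I, ℝ), ContDiffOn ℝ 1 ψ edgeDomain ∧
    ∀ z ∈ edgeDomain, edgeMap (z, ψ z) = ψ z ∧ ‖ψ z‖ ≤ 2 * (|z.1| + |z.2.1|) := by
  obtain ⟨ψ, h1, h2⟩ := exists_contDiffOn_fixedPoint (U := edgeDomain) (T := edgeMap)
    (r := 1 / 4) isOpen_edgeDomain contDiff_edgeMap.contDiffOn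
    (fun z hz ψ hψ φ hφ => norm_edgeMap_sub_le hz.2.2 (mem_ball_zero_iff.1 hψ).le
      (mem_ball_zero_iff.1 hφ).le)
    (fun z hz => (norm_edgeMap_zero_le hz.2.2 z.1 z.2.1).trans_lt (by
      have := hz.1; have := hz.2.1; linarith))
  refine ⟨ψ, h1, fun z hz => ⟨(h2 z hz).1, (h2 z hz).2.trans ?_⟩⟩
  have := norm_edgeMap_zero_le hz.2.2 z.1 z.2.1
  exact mul_le_mul_of_nonneg_left this (by norm_num)

/-- The small solution of the integral equation, as a function of `(α, β, L)`. -/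
def edgeSol : ℝ × ℝ × ℝ → C(I, ℝ) := exists_edgeSol.choose

theorem contDiffOn_edgeSol : ContDiffOn ℝ 1 edgeSol edgeDomain := exists_edgeSol.choose_spec.1

theorem edgeMap_edgeSol {z : ℝ × ℝ × ℝ} (hz : z ∈ edgeDomain) :
    edgeMap (z, edgeSol z) = edgeSol z := (exists_edgeSol.choose_spec.2 z hz).1

theorem norm_edgeSol_le {z : ℝ × ℝ × ℝ} (hz : z ∈ edgeDomain) :
    ‖edgeSol z‖ ≤ 2 * (|z.1| + |z.2.1|) := (exists_edgeSol.choose_spec.2 z hz).2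

theorem differentiableAt_edgeSol {z : ℝ × ℝ × ℝ} (hz : z ∈ edgeDomain) :
    DifferentiableAt ℝ edgeSol z :=
  (contDiffOn_edgeSol.contDiffAt (isOpen_edgeDomain.mem_nhds hz)).differentiableAt one_ne_zero

/-- Up to a cubic error the solution is `α exp (-L t) + β exp (-L (1 - t))`: the estimate for the
derivatives. -/
theorem abs_fderiv_edgeSol_sub_le {α β L : ℝ} (hz : (α, β, L) ∈ edgeDomain) (α' β' L' : ℝ)
    (t : I) :
    |fderiv ℝ edgeSol (α, β, L) (α', β', L') t - α' * Real.exp (-(L * t))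
        - β' * Real.exp (-(L * (1 - t)))|
      ≤ 48 * (|α| + |β|) ^ 2 * (|α'| + |β'|) + 4 * (|α| + |β|) * |L'| / L := by
  have hL : 0 < L := hz.2.2
  have hα : |α| < 1 / 16 := hz.1
  have hβ : |β| < 1 / 16 := hz.2.1
  set ψ := edgeSol (α, β, L) with hψdef
  set χ := fderiv ℝ edgeSol (α, β, L) (α', β', L') with hχdef
  set M := |α| + |β| with hM
  have hM0 : 0 ≤ M := by positivity
  have hM1 : M ≤ 1 / 8 := by rw [hM]; linarith
  have hψ : ‖ψ‖ ≤ 2 * M := norm_edgeSol_le hz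
  have hfix := fderiv_fixedPoint isOpen_edgeDomain (fun p hp => edgeMap_edgeSol hp) hz
    (contDiff_edgeMap.differentiable one_ne_zero _) (differentiableAt_edgeSol hz) (α', β', L')
  rw [fderiv_edgeMap, ← hχdef, ← hψdef] at hfix
  set A := α • -(leftDist * expFam leftDist L) + β • -(rightDist * expFam rightDist L)
          + kernelOp (greenKernelDeriv L) (ψ ^ 3) with hA
  set N := kernelOp (greenKernel L) (3 * ψ ^ 2 * χ) with hN
  have hAn : ‖A‖ ≤ 2 * M / L := by
    have a1 := norm_mul_expFam_le leftDist_nonneg hL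
    have a2 := norm_mul_expFam_le rightDist_nonneg hL
    have a3 := norm_kernelOp_greenKernelDeriv_le hL (ψ ^ 3)
    have a4 : ‖ψ ^ 3‖ ≤ M / 8 := by
      refine (norm_pow_le _ _).trans ((pow_le_pow_left₀ (norm_nonneg _) hψ 3).trans ?_)
      have : M ^ 2 ≤ (1 / 8) ^ 2 := pow_le_pow_left₀ hM0 hM1 2
      nlinarith
    have a5 : 8 / L * ‖ψ ^ 3‖ ≤ 8 / L * (M / 8) := mul_le_mul_of_nonneg_left a4 (by positivity)
    refine (norm_add₃_le ..).trans ?_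
    rw [norm_smul, norm_smul, norm_neg, norm_neg, Real.norm_eq_abs, Real.norm_eq_abs]
    have b1 := mul_le_mul_of_nonneg_left a1 (abs_nonneg α)
    have b2 := mul_le_mul_of_nonneg_left a2 (abs_nonneg β)
    calc _ ≤ |α| * L⁻¹ + |β| * L⁻¹ + 8 / L * (M / 8) := by linarith
      _ = 2 * M / L := by rw [hM]; field_simp; ring
  have hNn : ‖N‖ ≤ 24 * M ^ 2 * ‖χ‖ := by
    refine (norm_kernelOp_greenKernel_le hL _).trans ?_
    have c1 : (3 : C(I, ℝ)) * ψ ^ 2 * χ = (3 : ℝ) • (ψ ^ 2 * χ) := by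
      ext s; change 3 * ψ s ^ 2 * χ s = 3 * (ψ s ^ 2 * χ s); ring
    rw [c1, norm_smul, Real.norm_eq_abs, abs_of_pos (by norm_num : (0 : ℝ) < 3)]
    have c2 : ‖ψ ^ 2 * χ‖ ≤ (2 * M) ^ 2 * ‖χ‖ :=
      (norm_mul_le _ _).trans (mul_le_mul_of_nonneg_right
        ((norm_pow_le _ _).trans (pow_le_pow_left₀ (norm_nonneg _) hψ 2)) (norm_nonneg _))
    calc _ ≤ 2 * (3 * ((2 * M) ^ 2 * ‖χ‖)) := by gcongr
      _ = 24 * M ^ 2 * ‖χ‖ := by ring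
  have hLA : ‖L' • A‖ ≤ 2 * M * |L'| / L := by
    rw [norm_smul, Real.norm_eq_abs]
    calc _ ≤ |L'| * (2 * M / L) := mul_le_mul_of_nonneg_left hAn (abs_nonneg _)
      _ = _ := by ring
  have hM2 : M ^ 2 ≤ 1 / 64 := by nlinarith
  have hχ : ‖χ‖ ≤ 2 * (|α'| + |β'| + 2 * M * |L'| / L) := by
    have d1 : ‖χ‖ ≤ ‖α' • expFam leftDist L‖ + ‖β' • expFam rightDist L‖ + ‖L' • A‖ + ‖N‖ := by
      conv_lhs => rw [← hfix]
      exact (norm_add_le _ _).trans (add_le_add_left (norm_add₃_le ..) _)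
    rw [norm_smul, norm_smul, Real.norm_eq_abs, Real.norm_eq_abs] at d1
    have d2 := mul_le_of_le_one_right (abs_nonneg α') (norm_expFam_le leftDist_nonneg hL)
    have d3 := mul_le_of_le_one_right (abs_nonneg β') (norm_expFam_le rightDist_nonneg hL)
    have d4 : 24 * M ^ 2 * ‖χ‖ ≤ 1 / 2 * ‖χ‖ :=
      mul_le_mul_of_nonneg_right (by linarith) (norm_nonneg _)
    linarith
  have hval : χ t - α' * Real.exp (-(L * t)) - β' * Real.exp (-(L * (1 - t)))
      = (L' • A) t + N t := by
    have := congrArg (fun f : C(I, ℝ) => f t) hfix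
    simp only [ContinuousMap.add_apply, ContinuousMap.smul_apply, expFam_apply, leftDist_apply,
      rightDist_apply, smul_eq_mul] at this ⊢
    linarith
  rw [hval]
  have k1 := (L' • A).norm_coe_le_norm t
  have k2 := N.norm_coe_le_norm t
  rw [Real.norm_eq_abs] at k1 k2
  have k3 : 24 * M ^ 2 * ‖χ‖ ≤ 24 * M ^ 2 * (2 * (|α'| + |β'| + 2 * M * |L'| / L)) :=
    mul_le_mul_of_nonneg_left hχ (by positivity)
  have k4 : 24 * M ^ 2 * (2 * (2 * M * |L'| / L)) ≤ 2 * M * |L'| / L := by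
    have : 0 ≤ 2 * M * |L'| / L := by positivity
    nlinarith
  have k5 : 4 * M * |L'| / L = 2 * M * |L'| / L + 2 * M * |L'| / L := by ring
  calc _ ≤ |(L' • A) t| + |N t| := abs_add_le _ _
    _ ≤ _ := by rw [k5]; linarith

end

/-! ### Small functions of the scale and the waves -/

noncomputable section

open unitInterval Filter Topology Metric Set

/-- A function `f` of a scale `μ` and a small vector `y` is *small*, relative to an exponentially
small function `e` of `μ`, if it is `C¹`, vanishes for `y = 0`, has a `y`-derivative of size
`e μ + ‖y‖²` and a `μ`-derivative of size `μ⁻¹ ‖y‖`. -/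
structure IsSmall {ι : Type*} [Fintype ι] (e : ℝ → ℝ) (f : ℝ × (ι → ℝ) → ℝ) : Prop where
  contDiffOn : ContDiffOn ℝ 1 f (Ioi 0 ×ˢ ball 0 (1 / 16))
  map_zero : ∀ μ > 0, f (μ, 0) = 0
  bound : ∃ A : ℝ, 0 ≤ A ∧ ∀ μ > 0, ∀ y : ι → ℝ, ‖y‖ < 1 / 16 → ∀ (μ' : ℝ) (y' : ι → ℝ),
    |fderiv ℝ f (μ, y) (μ', y')| ≤ A * ((e μ + ‖y‖ ^ 2) * ‖y'‖ + μ⁻¹ * ‖y‖ * |μ'|)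

namespace IsSmall

variable {ι : Type*} [Fintype ι] {e : ℝ → ℝ} {f g : ℝ × (ι → ℝ) → ℝ}

theorem contDiffAt (hf : IsSmall e f) {μ : ℝ} (hμ : 0 < μ) {y : ι → ℝ} (hy : ‖y‖ < 1 / 16) :
    ContDiffAt ℝ 1 f (μ, y) :=
  hf.contDiffOn.contDiffAt ((isOpen_Ioi.prod isOpen_ball).mem_nhds ⟨hμ, mem_ball_zero_iff.2 hy⟩)

theorem hasFDerivAt (hf : IsSmall e f) {μ : ℝ} (hμ : 0 < μ) {y : ι → ℝ} (hy : ‖y‖ < 1 / 16) :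
    HasFDerivAt f (fderiv ℝ f (μ, y)) (μ, y) :=
  ((hf.contDiffAt hμ hy).differentiableAt one_ne_zero).hasFDerivAt

theorem zero (he : ∀ μ, 0 ≤ e μ) : IsSmall e (fun _ : ℝ × (ι → ℝ) => 0) where
  contDiffOn := contDiffOn_const
  map_zero _ _ := rfl
  bound := ⟨1, zero_le_one, fun μ hμ y _ μ' y' => by
    have := he μ
    simp only [fderiv_fun_const, Pi.zero_apply, zero_apply, abs_zero]
    positivity⟩

theorem add (hf : IsSmall e f) (hg : IsSmall e g) : IsSmall e (fun x => f x + g x) where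
  contDiffOn := hf.contDiffOn.add hg.contDiffOn
  map_zero μ hμ := by rw [hf.map_zero μ hμ, hg.map_zero μ hμ, add_zero]
  bound := by
    obtain ⟨A, hA, hfA⟩ := hf.bound
    obtain ⟨A', hA', hgA⟩ := hg.bound
    refine ⟨A + A', by positivity, fun μ hμ y hy μ' y' => ?_⟩
    rw [((hf.hasFDerivAt hμ hy).fun_add (hg.hasFDerivAt hμ hy)).fderiv,
      add_apply, add_mul]
    exact (abs_add_le _ _).trans (add_le_add (hfA μ hμ y hy μ' y') (hgA μ hμ y hy μ' y'))

theorem const_mul (hf : IsSmall e f) (c : ℝ) : IsSmall e (fun x => c * f x) where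
  contDiffOn := contDiffOn_const.mul hf.contDiffOn
  map_zero μ hμ := by rw [hf.map_zero μ hμ, mul_zero]
  bound := by
    obtain ⟨A, hA, hfA⟩ := hf.bound
    refine ⟨|c| * A, by positivity, fun μ hμ y hy μ' y' => ?_⟩
    rw [((hf.hasFDerivAt hμ hy).const_mul c).fderiv, smul_apply,
      smul_eq_mul, abs_mul, mul_assoc]
    exact mul_le_mul_of_nonneg_left (hfA μ hμ y hy μ' y') (abs_nonneg c)

theorem sum (he : ∀ μ, 0 ≤ e μ) {κ : Type*} (s : Finset κ) {F : κ → ℝ × (ι → ℝ) → ℝ}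
    (hF : ∀ k ∈ s, IsSmall e (F k)) : IsSmall e (fun x => ∑ k ∈ s, F k x) := by
  classical
  induction s using Finset.induction_on with
  | empty => simpa using zero he
  | insert a s ha ih =>
    simp only [Finset.sum_insert ha]
    exact (hF a (Finset.mem_insert_self a s)).add
      (ih fun k hk => hF k (Finset.mem_insert_of_mem hk))

theorem exists_lipschitz (hf : IsSmall e f) (he : ∀ μ, 0 ≤ e μ) :
    ∃ A : ℝ, 0 ≤ A ∧ ∀ μ > 0, ∀ r < (1 / 16 : ℝ), ∀ y z : ι → ℝ, ‖y‖ ≤ r → ‖z‖ ≤ r →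
      |f (μ, y) - f (μ, z)| ≤ A * (e μ + r ^ 2) * ‖y - z‖ := by
  obtain ⟨A, hA, hfA⟩ := hf.bound
  refine ⟨A, hA, fun μ hμ r hr y z hy hz => ?_⟩
  have hd : ∀ w ∈ closedBall (0 : ι → ℝ) r, HasFDerivWithinAt (fun w => f (μ, w))
      (fderiv ℝ f (μ, w) ∘L .inr ℝ ℝ (ι → ℝ)) (closedBall (0 : ι → ℝ) r) w := fun w hw =>
    ((hf.hasFDerivAt hμ ((mem_closedBall_zero_iff.1 hw).trans_lt hr)).comp w
      (hasFDerivAt_prodMk_right μ w)).hasFDerivWithinAt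
  refine (convex_closedBall (0 : ι → ℝ) r).norm_image_sub_le_of_norm_hasFDerivWithin_le hd
    (fun w hw => ?_) (mem_closedBall_zero_iff.2 hz) (mem_closedBall_zero_iff.2 hy)
  rw [mem_closedBall_zero_iff] at hw
  have := he μ
  refine ContinuousLinearMap.opNorm_le_bound _ (by positivity) fun v => ?_
  have h := hfA μ hμ w (hw.trans_lt hr) 0 v
  simp only [abs_zero, mul_zero, add_zero] at h
  refine h.trans ?_
  rw [mul_assoc]
  gcongr

end IsSmall

/-- The wave that arrives at the left end of an edge of length `L`, as a function of `(α, β, L)`: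
the value of the solution there minus the outgoing wave `α`. -/
def incLeft (z : ℝ × ℝ × ℝ) : ℝ := edgeSol z 0 - z.1

/-- The wave that arrives at the right end of an edge of length `L`, as a function of `(α, β, L)`:
the value of the solution there minus the outgoing wave `β`. -/
def incRight (z : ℝ × ℝ × ℝ) : ℝ := edgeSol z 1 - z.2.1

section

variable {ι : Type*} [Fintype ι]

theorem abs_apply_le_norm (y : ι → ℝ) (i : ι) : |y i| ≤ ‖y‖ := norm_le_pi_norm y i

theorem mem_edgeDomain {μ ℓ : ℝ} (hμ : 0 < μ) (hℓ : 0 < ℓ) {y : ι → ℝ} (hy : ‖y‖ < 1 / 16)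
    (i j : ι) : (y i, y j, μ * ℓ) ∈ edgeDomain :=
  ⟨(abs_apply_le_norm y i).trans_lt hy, (abs_apply_le_norm y j).trans_lt hy, mul_pos hμ hℓ⟩

theorem edgeSol_zero {L : ℝ} (hL : 0 < L) : edgeSol (0, 0, L) = 0 := by
  have := norm_edgeSol_le (z := (0, 0, L)) ⟨by norm_num, by norm_num, hL⟩
  simpa using this

/-- The arriving waves on an edge of length `μ ℓ` are small functions of `μ` and of the outgoing
waves, which are the coordinates `i` and `j` of `y`. -/
theorem isSmall_edge {e : ℝ → ℝ} {ℓ : ℝ} (hℓ : 0 < ℓ)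
    (hexp : ∀ μ > 0, Real.exp (-(μ * ℓ)) ≤ e μ) (i j : ι) :
    IsSmall e (fun x : ℝ × (ι → ℝ) => incLeft (x.2 i, x.2 j, x.1 * ℓ)) ∧
    IsSmall e (fun x : ℝ × (ι → ℝ) => incRight (x.2 i, x.2 j, x.1 * ℓ)) := by
  set G : ℝ × (ι → ℝ) → ℝ × ℝ × ℝ := fun x => (x.2 i, x.2 j, x.1 * ℓ) with hG
  have hGc : ContDiff ℝ 1 G := by rw [hG]; fun_prop
  have hmaps : MapsTo G (Ioi 0 ×ˢ ball 0 (1 / 16)) edgeDomain := fun x hx =>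
    mem_edgeDomain hx.1 hℓ (mem_ball_zero_iff.1 hx.2) i j
  have hsol : ContDiffOn ℝ 1 (fun x => edgeSol (G x)) (Ioi 0 ×ˢ ball 0 (1 / 16)) :=
    contDiffOn_edgeSol.comp hGc.contDiffOn hmaps
  have heval : ∀ t : I, ContDiffOn ℝ 1 (fun x => edgeSol (G x) t) (Ioi 0 ×ˢ ball 0 (1 / 16)) :=
    fun t => (ContinuousMap.evalCLM ℝ t : C(I, ℝ) →L[ℝ] ℝ).contDiff.comp_contDiffOn hsol
  have hder : ∀ t : I, ∀ μ > 0, ∀ y : ι → ℝ, ‖y‖ < 1 / 16 →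
      HasFDerivAt (fun x => edgeSol (G x) t)
        ((ContinuousMap.evalCLM ℝ t : C(I, ℝ) →L[ℝ] ℝ) ∘L (fderiv ℝ edgeSol (G (μ, y)) ∘L
          ((.proj i ∘L .snd ℝ ℝ (ι → ℝ)).prod ((.proj j ∘L .snd ℝ ℝ (ι → ℝ)).prod
            (ℓ • .fst ℝ ℝ (ι → ℝ)))))) (μ, y) := by
    intro t μ hμ y hy
    have h1 := (differentiableAt_edgeSol (mem_edgeDomain hμ hℓ hy i j)).hasFDerivAt
    have h2 : HasFDerivAt G ((.proj i ∘L .snd ℝ ℝ (ι → ℝ)).prod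
        ((.proj j ∘L .snd ℝ ℝ (ι → ℝ)).prod (ℓ • .fst ℝ ℝ (ι → ℝ)))) (μ, y) := by
      refine HasFDerivAt.prodMk ?_ (HasFDerivAt.prodMk ?_ ?_)
      · exact (.proj i ∘L .snd ℝ ℝ (ι → ℝ) : ℝ × (ι → ℝ) →L[ℝ] ℝ).hasFDerivAt
      · exact (.proj j ∘L .snd ℝ ℝ (ι → ℝ) : ℝ × (ι → ℝ) →L[ℝ] ℝ).hasFDerivAt
      · exact hasFDerivAt_fst.mul_const ℓ
    exact (ContinuousMap.evalCLM ℝ t : C(I, ℝ) →L[ℝ] ℝ).hasFDerivAt.comp (μ, y)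
      (HasFDerivAt.comp (μ, y) h1 h2)
  have hbd : ∀ t : I, ∀ μ > 0, ∀ y : ι → ℝ, ‖y‖ < 1 / 16 → ∀ (μ' : ℝ) (y' : ι → ℝ),
      |fderiv ℝ edgeSol (G (μ, y)) (y' i, y' j, ℓ * μ') t - y' i * Real.exp (-(μ * ℓ * t))
        - y' j * Real.exp (-(μ * ℓ * (1 - t)))|
      ≤ 384 * ‖y‖ ^ 2 * ‖y'‖ + 8 * (μ⁻¹ * ‖y‖ * |μ'|) := by
    intro t μ hμ y hy μ' y'
    refine (abs_fderiv_edgeSol_sub_le (mem_edgeDomain hμ hℓ hy i j) _ _ _ t).trans ?_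
    have a1 := abs_apply_le_norm y i
    have a2 := abs_apply_le_norm y j
    have a3 := abs_apply_le_norm y' i
    have a4 := abs_apply_le_norm y' j
    have b1 : 4 * (|y i| + |y j|) * |ℓ * μ'| / (μ * ℓ) = 4 * (|y i| + |y j|) * (μ⁻¹ * |μ'|) := by
      rw [abs_mul, abs_of_pos hℓ]; field_simp
    rw [b1]
    calc _ ≤ 48 * (‖y‖ + ‖y‖) ^ 2 * (‖y'‖ + ‖y'‖) + 4 * (‖y‖ + ‖y‖) * (μ⁻¹ * |μ'|) := by
          gcongr
      _ = _ := by ring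
  have hfin : ∀ μ > 0, ∀ y : ι → ℝ, ∀ (μ' : ℝ) (y' : ι → ℝ) (k : ι) (D : ℝ),
      |D - y' k * Real.exp (-(μ * ℓ))| ≤ 384 * ‖y‖ ^ 2 * ‖y'‖ + 8 * (μ⁻¹ * ‖y‖ * |μ'|) →
      |D| ≤ 384 * ((e μ + ‖y‖ ^ 2) * ‖y'‖ + μ⁻¹ * ‖y‖ * |μ'|) := by
    intro μ hμ y μ' y' k D hD
    have c1 : |y' k * Real.exp (-(μ * ℓ))| ≤ ‖y'‖ * e μ := by
      rw [abs_mul, abs_of_pos (Real.exp_pos _)]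
      exact mul_le_mul (abs_apply_le_norm y' k) (hexp μ hμ) (Real.exp_pos _).le (norm_nonneg _)
    have c2 := abs_sub_abs_le_abs_sub D (y' k * Real.exp (-(μ * ℓ)))
    have c3 : 0 ≤ μ⁻¹ * ‖y‖ * |μ'| := by positivity
    have c4 : 0 ≤ ‖y'‖ * e μ := le_trans (abs_nonneg _) c1
    nlinarith
  constructor
  · refine ⟨(heval 0).sub (by fun_prop), fun μ hμ => ?_, 384, by norm_num,
      fun μ hμ y hy μ' y' => hfin μ hμ y μ' y' j _ ?_⟩
    · simp [incLeft, edgeSol_zero (mul_pos hμ hℓ)]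
    · have h := (hder 0 μ hμ y hy).fun_sub
        (.proj i ∘L .snd ℝ ℝ (ι → ℝ) : ℝ × (ι → ℝ) →L[ℝ] ℝ).hasFDerivAt
      have h' : HasFDerivAt (fun x : ℝ × (ι → ℝ) => incLeft (x.2 i, x.2 j, x.1 * ℓ)) _ (μ, y) := h
      rw [h'.fderiv]
      have := hbd 0 μ hμ y hy μ' y'
      simpa using this
  · refine ⟨(heval 1).sub (by fun_prop), fun μ hμ => ?_, 384, by norm_num,
      fun μ hμ y hy μ' y' => hfin μ hμ y μ' y' i _ ?_⟩
    · simp [incRight, edgeSol_zero (mul_pos hμ hℓ)]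
    · have h := (hder 1 μ hμ y hy).fun_sub
        (.proj j ∘L .snd ℝ ℝ (ι → ℝ) : ℝ × (ι → ℝ) →L[ℝ] ℝ).hasFDerivAt
      have h' : HasFDerivAt (fun x : ℝ × (ι → ℝ) => incRight (x.2 i, x.2 j, x.1 * ℓ)) _ (μ, y) :=
        h
      rw [h'.fderiv]
      have := hbd 1 μ hμ y hy μ' y'
      rw [sub_right_comm] at this
      simpa using this

/-- Minus the derivative at the end of a half-line is `c - rayDefect c`, where `c` is the value of
the solution there. -/
def rayDefect (c : ℝ) : ℝ := c - c * Real.sqrt (1 - c ^ 2)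

theorem isSmall_ray {e : ℝ → ℝ} (he : ∀ μ, 0 ≤ e μ) (i : ι) :
    IsSmall e (fun x : ℝ × (ι → ℝ) => rayDefect (x.2 i)) := by
  have hpos : ∀ c : ℝ, |c| < 1 / 16 → 0 < 1 - c ^ 2 := fun c hc => by
    have := sq_lt_sq' (abs_lt.1 hc).1 (abs_lt.1 hc).2
    norm_num at this
    linarith
  have hder : ∀ c : ℝ, |c| < 1 / 16 → HasDerivAt rayDefect
      (1 - (1 * Real.sqrt (1 - c ^ 2) + c * (-(2 * c) / (2 * Real.sqrt (1 - c ^ 2))))) c := by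
    intro c hc
    have h1 : HasDerivAt (fun c : ℝ => 1 - c ^ 2) (-(2 * c)) c := by
      simpa using (hasDerivAt_pow 2 c).const_sub 1
    exact (hasDerivAt_id' c).sub ((hasDerivAt_id' c).mul (h1.sqrt (hpos c hc).ne'))
  refine ⟨?_, fun μ hμ => by simp [rayDefect], 3, by norm_num, fun μ hμ y hy μ' y' => ?_⟩
  · refine ContDiffOn.sub (by fun_prop) (ContDiffOn.mul (by fun_prop) ?_)
    refine ContDiffOn.sqrt (by fun_prop) fun x hx => (hpos _ ?_).ne'
    exact (abs_apply_le_norm x.2 i).trans_lt (mem_ball_zero_iff.1 hx.2)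
  · have hc : |y i| < 1 / 16 := (abs_apply_le_norm y i).trans_lt hy
    let P : ℝ × (ι → ℝ) →L[ℝ] ℝ := .proj i ∘L .snd ℝ ℝ (ι → ℝ)
    have hi : HasFDerivAt (fun x : ℝ × (ι → ℝ) => x.2 i) P (μ, y) := P.hasFDerivAt
    have h := HasDerivAt.comp_hasFDerivAt (μ, y) (hder (y i) hc) hi
    change HasFDerivAt (fun x : ℝ × (ι → ℝ) => rayDefect (x.2 i)) _ (μ, y) at h
    rw [h.fderiv]
    simp only [P, smul_apply, ContinuousLinearMap.comp_apply, ContinuousLinearMap.coe_snd',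
      ContinuousLinearMap.proj_apply, smul_eq_mul, abs_mul]
    set c := y i with hcdef
    set s := Real.sqrt (1 - c ^ 2) with hs
    have hs2 : s ^ 2 = 1 - c ^ 2 := Real.sq_sqrt (hpos c hc).le
    have hs0 : 0 < s := Real.sqrt_pos.2 (hpos c hc)
    have hc2 : c ^ 2 ≤ 1 / 256 := by
      have := sq_lt_sq' (abs_lt.1 hc).1 (abs_lt.1 hc).2
      norm_num at this; linarith
    have hs1 : 1 / 2 ≤ s := by nlinarith
    have hs3 : s ≤ 1 := by nlinarith [sq_nonneg c]
    have key : |1 - (1 * s + c * (-(2 * c) / (2 * s)))| ≤ 3 * c ^ 2 := by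
      have e1 : 1 - (1 * s + c * (-(2 * c) / (2 * s))) = (1 - s) + c ^ 2 / s := by
        field_simp; ring
      have e2 : c ^ 2 / s ≤ 2 * c ^ 2 := by
        rw [div_le_iff₀ hs0]; nlinarith [sq_nonneg c]
      have e3 : 0 ≤ c ^ 2 / s := by positivity
      rw [e1, abs_of_nonneg (by linarith)]
      nlinarith
    have hcy : c ^ 2 ≤ ‖y‖ ^ 2 := by
      rw [← sq_abs c]; exact pow_le_pow_left₀ (abs_nonneg _) (abs_apply_le_norm y i) 2
    have hy' := abs_apply_le_norm y' i
    have := he μ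
    calc _ ≤ 3 * c ^ 2 * ‖y'‖ := mul_le_mul key hy' (abs_nonneg _) (by positivity)
      _ ≤ 3 * ‖y‖ ^ 2 * ‖y'‖ := by gcongr
      _ ≤ _ := by
        have : 0 ≤ e μ * ‖y'‖ + μ⁻¹ * ‖y‖ * |μ'| := by positivity
        linarith

end

end

/-! ### Systems of equations with small nonlinearity -/

noncomputable section

open Filter Topology Metric Set

section

variable {ι : Type*} [Fintype ι] {P : Type*} [NormedAddCommGroup P] [NormedSpace ℝ P]

/-- The map whose fixed points in `y` solve the system `y i = (π p) i + f i (μ, y)`. -/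
def systemMap (π : P →L[ℝ] (ι → ℝ)) (f : ι → ℝ × (ι → ℝ) → ℝ) (x : (P × ℝ) × (ι → ℝ)) : ι → ℝ :=
  fun i => π x.1.1 i + f i (x.1.2, x.2)

/-- A system of equations `y i = (π p) i + f i (μ, y)` with small `f i` has, for small `p` and
large `μ`, a solution that is a `C¹` function of `(p, μ)`. -/
theorem exists_solution_of_isSmall [CompleteSpace P] {e : ℝ → ℝ} (he : ∀ μ, 0 ≤ e μ)
    (he0 : Tendsto e atTop (𝓝 0)) (π : P →L[ℝ] (ι → ℝ)) (hπ : ∀ p, ‖π p‖ ≤ ‖p‖)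
    {f : ι → ℝ × (ι → ℝ) → ℝ} (hf : ∀ i, IsSmall e (f i)) :
    ∃ p₀ > (0 : ℝ), p₀ < 1 / 64 ∧ ∃ μ₀ > (0 : ℝ), (∀ μ > μ₀, e μ ≤ 1) ∧ ∃ C : ℝ, 0 ≤ C ∧
    ∃ y : P × ℝ → (ι → ℝ), ContDiffOn ℝ 1 y (ball 0 p₀ ×ˢ Ioi μ₀) ∧
      ∀ (p : P) (μ : ℝ), ‖p‖ < p₀ → μ₀ < μ →
        (∀ i, y (p, μ) i = π p i + f i (μ, y (p, μ))) ∧ ‖y (p, μ)‖ ≤ 2 * ‖p‖ ∧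
        ∀ (p' : P) (μ' : ℝ), ‖fderiv ℝ y (p, μ) (p', μ')‖ ≤ C * (‖p'‖ + μ⁻¹ * ‖p‖ * |μ'|) := by
  choose A hA0 hA using fun i => (hf i).exists_lipschitz he
  choose A' hA0' hA' using fun i => (hf i).bound
  set K : ℝ := 1 + ∑ i, A i + ∑ i, A' i with hK
  have hK1 : 1 ≤ K := by
    have := Finset.sum_nonneg fun i (_ : i ∈ Finset.univ) => hA0 i
    have := Finset.sum_nonneg fun i (_ : i ∈ Finset.univ) => hA0' i
    linarith
  have hAK : ∀ i, A i ≤ K ∧ A' i ≤ K := fun i => by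
    have h1 := Finset.single_le_sum (fun j (_ : j ∈ Finset.univ) => hA0 j) (Finset.mem_univ i)
    have h2 := Finset.single_le_sum (fun j (_ : j ∈ Finset.univ) => hA0' j) (Finset.mem_univ i)
    have h3 := hA0 i
    have h4 := hA0' i
    constructor <;> linarith
  -- on the ball of radius `r`, for `e μ ≤ ε`, the map is a contraction with constant `1 / 2`
  set r : ℝ := 1 / (64 * K) with hr
  set ε : ℝ := 1 / (8 * K) with hε
  have hr0 : 0 < r := by positivity
  have hε0 : 0 < ε := by positivity
  have hr1 : r ≤ 1 / 64 := by
    rw [hr, div_le_div_iff_of_pos_left one_pos (by positivity) (by norm_num)]; linarith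
  have hε1 : ε ≤ 1 := by
    rw [hε, div_le_one (by positivity)]; linarith
  have hsmall : K * (ε + r ^ 2) ≤ 1 / 4 := by
    have h1 : K * ε = 1 / 8 := by rw [hε]; field_simp
    have h2 : K * r = 1 / 64 := by rw [hr]; field_simp
    nlinarith
  obtain ⟨μ₁, hμ₁⟩ := (he0.eventually (ge_mem_nhds hε0)).exists_forall_of_atTop
  set μ₀ := max μ₁ 1 with hμ₀
  have hμ₀0 : 0 < μ₀ := lt_of_lt_of_le one_pos (le_max_right _ _)
  have heμ : ∀ μ > μ₀, e μ ≤ ε := fun μ hμ => hμ₁ μ ((le_max_left _ _).trans hμ.le)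
  set U : Set (P × ℝ) := ball 0 (r / 2) ×ˢ Ioi μ₀ with hU
  have hUo : IsOpen U := isOpen_ball.prod isOpen_Ioi
  set T := systemMap π f with hT
  have hTc : ContDiffOn ℝ 1 T (U ×ˢ ball 0 r) := by
    rw [contDiffOn_pi]
    intro i
    refine ContDiffOn.add (by fun_prop) ((hf i).contDiffOn.comp (by fun_prop) fun x hx => ?_)
    exact ⟨hμ₀0.trans hx.1.2, ball_subset_ball (by linarith) hx.2⟩
  have hlip : ∀ z ∈ U, ∀ y ∈ ball (0 : ι → ℝ) r, ∀ y' ∈ ball (0 : ι → ℝ) r,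
      ‖T (z, y) - T (z, y')‖ ≤ 1 / 2 * ‖y - y'‖ := by
    intro z hz y hy y' hy'
    rw [mem_ball_zero_iff] at hy hy'
    rw [pi_norm_le_iff_of_nonneg (by positivity)]
    intro i
    have h1 := hA i z.2 (hμ₀0.trans hz.2) r (by linarith) y y' hy.le hy'.le
    have h2 : T (z, y) i - T (z, y') i = f i (z.2, y) - f i (z.2, y') := by
      simp [hT, systemMap]
    rw [Pi.sub_apply, h2, Real.norm_eq_abs]
    refine h1.trans (mul_le_mul_of_nonneg_right ?_ (norm_nonneg _))
    have h3 := heμ z.2 hz.2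
    have h4 := he z.2
    have := mul_le_mul (hAK i).1 (add_le_add_left h3 (r ^ 2)) (by positivity)
      (by positivity)
    linarith
  have hTz : ∀ z ∈ U, ‖T (z, 0)‖ ≤ ‖z.1‖ := by
    intro z hz
    have : T (z, 0) = π z.1 := by
      ext i
      simp [hT, systemMap, (hf i).map_zero z.2 (hμ₀0.trans hz.2)]
    rw [this]
    exact hπ _
  obtain ⟨y, hyc, hy⟩ := exists_contDiffOn_fixedPoint hUo hTc hlip fun z hz =>
    (hTz z hz).trans_lt (mem_ball_zero_iff.1 hz.1)
  refine ⟨r / 2, by positivity, by linarith, μ₀, hμ₀0, fun μ hμ => (heμ μ hμ).trans hε1,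
    2 * (1 + 2 * K), by positivity, y, hyc, fun p μ hp hμ => ?_⟩
  have hz : (p, μ) ∈ U := ⟨mem_ball_zero_iff.2 hp, hμ⟩
  have hμ0 : 0 < μ := hμ₀0.trans hμ
  have hyn : ‖y (p, μ)‖ ≤ 2 * ‖p‖ := (hy _ hz).2.trans
    (mul_le_mul_of_nonneg_left (hTz _ hz) (by norm_num))
  have hyr : ‖y (p, μ)‖ < r := by linarith
  have hy16 : ‖y (p, μ)‖ < 1 / 16 := by linarith
  refine ⟨fun i => (congrFun (hy _ hz).1 i).symm, hyn, fun p' μ' => ?_⟩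
  have hTd : DifferentiableAt ℝ T ((p, μ), y (p, μ)) :=
    (hTc.contDiffAt ((hUo.prod isOpen_ball).mem_nhds
      ⟨hz, mem_ball_zero_iff.2 hyr⟩)).differentiableAt one_ne_zero
  have hfix := fderiv_fixedPoint hUo (fun q hq => (hy q hq).1) hz hTd
    ((hyc.contDiffAt (hUo.mem_nhds hz)).differentiableAt one_ne_zero) (p', μ')
  set χ := fderiv ℝ y (p, μ) (p', μ') with hχ
  have hcomp : ∀ i, fderiv ℝ T ((p, μ), y (p, μ)) ((p', μ'), χ) i
      = π p' i + fderiv ℝ (f i) (μ, y (p, μ)) (μ', χ) := by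
    intro i
    have h1 : HasFDerivAt (fun x : (P × ℝ) × (ι → ℝ) => T x i)
        (.proj i ∘L fderiv ℝ T ((p, μ), y (p, μ))) ((p, μ), y (p, μ)) :=
      hasFDerivAt_pi'.1 hTd.hasFDerivAt i
    let Q : (P × ℝ) × (ι → ℝ) →L[ℝ] ℝ × (ι → ℝ) :=
      (ContinuousLinearMap.snd ℝ P ℝ ∘L .fst ℝ (P × ℝ) (ι → ℝ)).prod (.snd ℝ (P × ℝ) (ι → ℝ))
    let R : (P × ℝ) × (ι → ℝ) →L[ℝ] ℝ := (ContinuousLinearMap.proj (R := ℝ) (φ := fun _ : ι => ℝ) i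
      ∘L π) ∘L (ContinuousLinearMap.fst ℝ P ℝ ∘L .fst ℝ (P × ℝ) (ι → ℝ))
    have h2 : HasFDerivAt (fun x => f i (Q x)) (fderiv ℝ (f i) (μ, y (p, μ)) ∘L Q)
        ((p, μ), y (p, μ)) :=
      HasFDerivAt.comp _ ((hf i).hasFDerivAt hμ0 hy16) Q.hasFDerivAt
    have h3 : HasFDerivAt (fun x : (P × ℝ) × (ι → ℝ) => T x i)
        (R + fderiv ℝ (f i) (μ, y (p, μ)) ∘L Q) ((p, μ), y (p, μ)) := R.hasFDerivAt.add h2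
    have := congrArg (fun B : (P × ℝ) × (ι → ℝ) →L[ℝ] ℝ => B ((p', μ'), χ)) (h1.unique h3)
    simpa [R, Q] using this
  have hnorm : ‖χ‖ ≤ ‖p'‖ + 1 / 4 * ‖χ‖ + K * (μ⁻¹ * (2 * ‖p‖) * |μ'|) := by
    conv_lhs => rw [← hfix]
    rw [pi_norm_le_iff_of_nonneg (by positivity)]
    intro i
    rw [hcomp i]
    refine (norm_add_le _ _).trans ?_
    have h1 : ‖π p' i‖ ≤ ‖p'‖ := (norm_le_pi_norm _ i).trans (hπ p')
    have h2 := hA' i μ hμ0 _ hy16 μ' χ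
    rw [← Real.norm_eq_abs] at h2
    have h3 : A' i * ((e μ + ‖y (p, μ)‖ ^ 2) * ‖χ‖ + μ⁻¹ * ‖y (p, μ)‖ * |μ'|)
        ≤ K * ((ε + r ^ 2) * ‖χ‖ + μ⁻¹ * (2 * ‖p‖) * |μ'|) := by
      have := heμ μ hμ
      have := he μ
      have := (hAK i).2
      have := hA0' i
      gcongr
    have h4 : K * ((ε + r ^ 2) * ‖χ‖) ≤ 1 / 4 * ‖χ‖ := by
      rw [← mul_assoc]
      exact mul_le_mul_of_nonneg_right hsmall (norm_nonneg _)
    linarith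
  have h5 : 0 ≤ μ⁻¹ * ‖p‖ * |μ'| := by positivity
  have h6 := norm_nonneg p'
  nlinarith

/-- A small function evaluated along the solution of a small system. -/
theorem IsSmall.comp_solution {e : ℝ → ℝ} (he : ∀ μ, 0 ≤ e μ) {f : ℝ × (ι → ℝ) → ℝ}
    (hf : IsSmall e f) {C : ℝ} (hC : 0 ≤ C) :
    ∃ C' : ℝ, 0 ≤ C' ∧ ∀ (y : P × ℝ → (ι → ℝ)) (p : P) (μ : ℝ), 0 < μ → ‖p‖ < 1 / 64 → e μ ≤ 1 →
      ‖y (p, μ)‖ ≤ 2 * ‖p‖ → DifferentiableAt ℝ y (p, μ) →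
      (∀ (p' : P) (μ' : ℝ),
        ‖fderiv ℝ y (p, μ) (p', μ')‖ ≤ C * (‖p'‖ + μ⁻¹ * ‖p‖ * |μ'|)) →
      |f (μ, y (p, μ))| ≤ C' * (‖p‖ * e μ + ‖p‖ ^ 3) ∧
      ∃ D : P × ℝ →L[ℝ] ℝ, HasFDerivAt (fun x : P × ℝ => f (x.2, y x)) D (p, μ) ∧
        ∀ (p' : P) (μ' : ℝ),
          |D (p', μ')| ≤ C' * ((e μ + ‖p‖ ^ 2) * ‖p'‖ + μ⁻¹ * ‖p‖ * |μ'|) := by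
  obtain ⟨A, hA0, hA⟩ := hf.exists_lipschitz he
  obtain ⟨A', hA0', hA'⟩ := hf.bound
  refine ⟨8 * A + A' * (8 * C + 2), by positivity, fun y p μ hμ hp heμ hy hyd hyf => ?_⟩
  have hy16 : ‖y (p, μ)‖ < 1 / 16 := by linarith
  have he' := he μ
  constructor
  · have h1 := hA μ hμ (2 * ‖p‖) (by linarith) (y (p, μ)) 0 hy (by simp)
    rw [hf.map_zero μ hμ, sub_zero, sub_zero] at h1
    calc |f (μ, y (p, μ))| ≤ A * (e μ + (2 * ‖p‖) ^ 2) * (2 * ‖p‖) := h1.trans (by gcongr)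
      _ = A * (2 * (‖p‖ * e μ) + 8 * ‖p‖ ^ 3) := by ring
      _ ≤ A * (8 * (‖p‖ * e μ) + 8 * ‖p‖ ^ 3) := by gcongr; norm_num
      _ = 8 * A * (‖p‖ * e μ + ‖p‖ ^ 3) := by ring
      _ ≤ _ := by
        refine mul_le_mul_of_nonneg_right ?_ (by positivity)
        have : 0 ≤ A' * (8 * C + 2) := by positivity
        linarith
  · refine ⟨fderiv ℝ f (μ, y (p, μ)) ∘L (ContinuousLinearMap.snd ℝ P ℝ).prod
      (fderiv ℝ y (p, μ)), ?_, fun p' μ' => ?_⟩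
    · exact HasFDerivAt.comp (p, μ) (hf.hasFDerivAt hμ hy16)
        ((hasFDerivAt_snd (p := (p, μ))).prodMk hyd.hasFDerivAt)
    · have h1 := hA' μ hμ _ hy16 μ' (fderiv ℝ y (p, μ) (p', μ'))
      have h2 := hyf p' μ'
      refine (le_of_eq (by simp)).trans (h1.trans ?_)
      have hp0 := norm_nonneg p
      have hp0' := norm_nonneg p'
      set X := μ⁻¹ * ‖p‖ * |μ'| with hX
      have hX0 : 0 ≤ X := by positivity
      have h3 : e μ + (2 * ‖p‖) ^ 2 ≤ 4 * (e μ + ‖p‖ ^ 2) := by nlinarith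
      have h4 : e μ + ‖p‖ ^ 2 ≤ 2 := by nlinarith
      calc _ ≤ A' * ((e μ + (2 * ‖p‖) ^ 2) * (C * (‖p'‖ + X)) + μ⁻¹ * (2 * ‖p‖) * |μ'|) := by
            gcongr
        _ ≤ A' * (4 * (e μ + ‖p‖ ^ 2) * (C * (‖p'‖ + X)) + 2 * X) := by
            rw [hX]
            have : μ⁻¹ * (2 * ‖p‖) * |μ'| = 2 * (μ⁻¹ * ‖p‖ * |μ'|) := by ring
            rw [this]
            gcongr
        _ = A' * (4 * C * ((e μ + ‖p‖ ^ 2) * ‖p'‖) + 4 * C * ((e μ + ‖p‖ ^ 2) * X) + 2 * X) := by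
            ring
        _ ≤ A' * ((8 * C + 2) * ((e μ + ‖p‖ ^ 2) * ‖p'‖) + 4 * C * (2 * X) + 2 * X) := by
            gcongr
            linarith
        _ = A' * (8 * C + 2) * ((e μ + ‖p‖ ^ 2) * ‖p'‖ + X) := by ring
        _ ≤ _ := by
            refine mul_le_mul_of_nonneg_right ?_ (by positivity)
            linarith

end

end

/-! ### Solutions of the differential equation on one edge -/

noncomputable section

open unitInterval Filter Topology

theorem Continuous.memLp_Icc {f : ℝ → ℝ} (hf : Continuous f) (a b : ℝ) :
    MemLp f 2 (volume.restrict (Set.Icc a b)) := by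
  obtain ⟨C, hC⟩ := isCompact_Icc.exists_bound_of_continuousOn (hf.continuousOn (s := Set.Icc a b))
  exact MemLp.of_bound hf.aestronglyMeasurable C ((ae_restrict_mem measurableSet_Icc).mono hC)

/-- The functions of class `C²` on the real line, restricted to a bounded interval. -/
def H2Fun.ofDeriv {L : ℝ} (f f' f'' : ℝ → ℝ) (h1 : ∀ x, HasDerivAt f (f' x) x)
    (h2 : ∀ x, HasDerivAt f' (f'' x) x) (hc : Continuous f'') : H2Fun (Set.Icc 0 L) :=
  have hc0 : Continuous f := continuous_iff_continuousAt.2 fun x => (h1 x).continuousAt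
  have hc1 : Continuous f' := continuous_iff_continuousAt.2 fun x => (h2 x).continuousAt
  { val := f
    d1 := f'
    d2 := f''
    memLp_val := hc0.memLp_Icc 0 L
    memLp_d1 := hc1.memLp_Icc 0 L
    memLp_d2 := hc.memLp_Icc 0 L
    val_eq := fun x _ => by
      rw [intervalIntegral.integral_eq_sub_of_hasDerivAt (fun y _ => h1 y)
        (hc1.intervalIntegrable _ _)]
      ring
    d1_eq := fun x _ => by
      rw [intervalIntegral.integral_eq_sub_of_hasDerivAt (fun y _ => h2 y)
        (hc.intervalIntegrable _ _)]
      ring }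

/-- The energy identity `(ψ ψ')' = ψ'² + ψ² - 2 ψ⁴` bounds the `H²` norm of a small solution by its
boundary values. -/
theorem H2Fun.normSq_ofDeriv_le {L : ℝ} (hL : 0 ≤ L) {f f' f'' : ℝ → ℝ}
    (h1 : ∀ x, HasDerivAt f (f' x) x) (h2 : ∀ x, HasDerivAt f' (f'' x) x) (hc : Continuous f'')
    (hode : ∀ x ∈ Set.Icc 0 L, f'' x = f x - 2 * f x ^ 3)
    (hb : ∀ x ∈ Set.Icc 0 L, |f x| ≤ 1 / 4) :
    (H2Fun.ofDeriv (L := L) f f' f'' h1 h2 hc).normSq ≤ 3 * (f L * f' L - f 0 * f' 0) := by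
  have hc0 : Continuous f := continuous_iff_continuousAt.2 fun x => (h1 x).continuousAt
  have hc1 : Continuous f' := continuous_iff_continuousAt.2 fun x => (h2 x).continuousAt
  have hint : ∀ g : ℝ → ℝ, Continuous g → IntegrableOn g (Set.Icc 0 L) := fun g hg =>
    hg.continuousOn.integrableOn_compact isCompact_Icc
  have e1 : (H2Fun.ofDeriv (L := L) f f' f'' h1 h2 hc).normSq
      = ∫ x in Set.Icc 0 L, (f x ^ 2 + f' x ^ 2 + f'' x ^ 2) := by
    rw [integral_add (hint (fun x => f x ^ 2 + f' x ^ 2) (by fun_prop))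
      (hint (fun x => f'' x ^ 2) (by fun_prop)),
      integral_add (hint (fun x => f x ^ 2) (by fun_prop)) (hint (fun x => f' x ^ 2) (by fun_prop))]
    rfl
  have e2 : ∫ x in (0 : ℝ)..L, (f' x * f' x + f x * f'' x) = f L * f' L - f 0 * f' 0 :=
    intervalIntegral.integral_eq_sub_of_hasDerivAt (fun x _ => (h1 x).mul (h2 x))
      ((by fun_prop : Continuous fun x => f' x * f' x + f x * f'' x).intervalIntegrable _ _)
  rw [e1, ← e2, intervalIntegral.integral_of_le hL, ← integral_Icc_eq_integral_Ioc,
    ← integral_const_mul]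
  refine setIntegral_mono_on (hint _ (by fun_prop)) (hint _ (by fun_prop)) measurableSet_Icc
    fun x hx => ?_
  rw [hode x hx]
  have h3 : f x ^ 2 ≤ 1 / 16 := by
    rw [← sq_abs]
    calc |f x| ^ 2 ≤ (1 / 4) ^ 2 := pow_le_pow_left₀ (abs_nonneg _) (hb x hx) 2
      _ = 1 / 16 := by norm_num
  have h4 : (f x - 2 * f x ^ 3) ^ 2 = f x ^ 2 * (1 - 2 * f x ^ 2) ^ 2 := by ring
  have h5 : (1 - 2 * f x ^ 2) ^ 2 ≤ 1 := by nlinarith [sq_nonneg (f x)]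
  have h6 := mul_le_mul_of_nonneg_left h5 (sq_nonneg (f x))
  rw [h4]
  nlinarith [sq_nonneg (f x), sq_nonneg (f' x), mul_nonneg (sq_nonneg (f x)) (sub_nonneg.2 h3)]

/-- The solution of the integral equation, stretched to the interval `[0, L]`, satisfies the
unscaled integral equation there. -/
theorem edgeSol_stretched {α β L : ℝ} (hz : (α, β, L) ∈ edgeDomain) {w : ℝ → ℝ}
    (hw : ∀ x, w x = edgeSol (α, β, L) (Set.projIcc 0 1 zero_le_one (x / L))) {x : ℝ}
    (hx : x ∈ Set.Icc 0 L) :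
    w x = Real.exp x * (β * Real.exp (-L) + ∫ y in x..L, Real.exp (-y) * w y ^ 3)
      + Real.exp (-x) * (α + ∫ y in (0 : ℝ)..x, Real.exp y * w y ^ 3) := by
  have hL : 0 < L := hz.2.2
  set ψ := edgeSol (α, β, L) with hψ
  have hwc : Continuous w := by
    have : w = fun x => ψ (Set.projIcc 0 1 zero_le_one (x / L)) := funext hw
    rw [this]
    exact ψ.continuous.comp (continuous_projIcc.comp (by fun_prop))
  have hwI : ∀ s : I, w (L * s) = ψ s := fun s => by
    rw [hw, mul_div_cancel_left₀ _ hL.ne', Set.projIcc_val]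
  set t : I := ⟨x / L, div_nonneg hx.1 hL.le, div_le_one_of_le₀ hx.2 hL.le⟩ with ht
  have htx : L * (t : ℝ) = x := mul_div_cancel₀ x hL.ne'
  have h1 : ψ t = α * Real.exp (-(L * t)) + β * Real.exp (-(L * (1 - t)))
      + ∫ s : I, L * Real.exp (-(L * |(t : ℝ) - s|)) * ψ s ^ 3 := by
    conv_lhs => rw [hψ, ← edgeMap_edgeSol hz]
    simp only [edgeMap, ContinuousMap.add_apply, ContinuousMap.smul_apply, expFam_apply,
      leftDist_apply, rightDist_apply, smul_eq_mul, kernelOp_apply, greenKernel, distFun_apply,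
      ContinuousMap.pow_apply, hψ]
  have h2 : ∫ s : I, L * Real.exp (-(L * |(t : ℝ) - s|)) * ψ s ^ 3
      = ∫ y in (0 : ℝ)..L, Real.exp (-|x - y|) * w y ^ 3 := by
    have h3 := integral_unitInterval_eq
      (fun s => L * (Real.exp (-|x - L * s|) * w (L * s) ^ 3))
    have h4 := intervalIntegral.smul_integral_comp_mul_left (a := 0) (b := 1)
      (fun y => Real.exp (-|x - y|) * w y ^ 3) L
    rw [mul_zero, mul_one] at h4
    rw [intervalIntegral.integral_const_mul] at h3
    rw [← h4, smul_eq_mul, ← h3]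
    refine integral_congr_ae (Eventually.of_forall fun s => ?_)
    have h5 : L * |(t : ℝ) - s| = |x - L * s| := by
      rw [← htx, ← mul_sub, abs_mul, abs_of_pos hL]
    simp only [hwI, h5]
    ring
  have hi : ∀ a b : ℝ, IntervalIntegrable (fun y => Real.exp (-|x - y|) * w y ^ 3) volume a b :=
    fun a b => (by fun_prop : Continuous fun y => Real.exp (-|x - y|) * w y ^ 3).intervalIntegrable
      a b
  have h6 : ∫ y in (0 : ℝ)..x, Real.exp (-|x - y|) * w y ^ 3
      = Real.exp (-x) * ∫ y in (0 : ℝ)..x, Real.exp y * w y ^ 3 := by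
    rw [← intervalIntegral.integral_const_mul]
    refine intervalIntegral.integral_congr fun y hy => ?_
    rw [Set.uIcc_of_le hx.1] at hy
    rw [abs_of_nonneg (by linarith [hy.2]), ← mul_assoc, ← Real.exp_add]
    congr 2; ring
  have h7 : ∫ y in x..L, Real.exp (-|x - y|) * w y ^ 3
      = Real.exp x * ∫ y in x..L, Real.exp (-y) * w y ^ 3 := by
    rw [← intervalIntegral.integral_const_mul]
    refine intervalIntegral.integral_congr fun y hy => ?_
    rw [Set.uIcc_of_le hx.2] at hy
    rw [abs_of_nonpos (by linarith [hy.1]), ← mul_assoc, ← Real.exp_add]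
    congr 2; ring
  have h8 : w x = ψ t := by rw [← hwI, htx]
  rw [h8, h1, h2, ← intervalIntegral.integral_add_adjacent_intervals (hi 0 x) (hi x L), h6, h7,
    mul_sub, mul_one, htx]
  have h9 : Real.exp (-(L - x)) = Real.exp x * Real.exp (-L) := by
    rw [← Real.exp_add]; congr 1; ring
  rw [h9]
  ring

/-- The solution of the nonlinear equation on an edge of length `L` from which the waves `α` and
`β` emanate at the two ends. -/
theorem exists_H2Fun_edge {α β L : ℝ} (hz : (α, β, L) ∈ edgeDomain) :
    ∃ f : H2Fun (Set.Icc 0 L),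
      (∀ x ∈ Set.Icc 0 L, f.d2 x = f.val x - 2 * f.val x ^ 3) ∧
      (∀ x ∈ Set.Icc 0 L, |f.val x| ≤ 1 / 4) ∧
      f.val 0 = α + incLeft (α, β, L) ∧ f.val L = β + incRight (α, β, L) ∧
      f.d1 0 = incLeft (α, β, L) - α ∧ f.d1 L = β - incRight (α, β, L) ∧
      f.normSq ≤ 48 * (|α| + |β|) ^ 2 := by
  have hL : 0 < L := hz.2.2
  have hα : |α| < 1 / 16 := hz.1
  have hβ : |β| < 1 / 16 := hz.2.1
  set ψ := edgeSol (α, β, L) with hψ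
  set w : ℝ → ℝ := fun x => ψ (Set.projIcc 0 1 zero_le_one (x / L)) with hw
  have hwc : Continuous w := ψ.continuous.comp (continuous_projIcc.comp (by fun_prop))
  have hwb : ∀ x, |w x| ≤ 2 * (|α| + |β|) := fun x =>
    (ψ.norm_coe_le_norm _).trans (norm_edgeSol_le hz)
  -- the solution is the sum of a wave `u` that moves to the left and a wave `v` that moves to the
  -- right, with `u' = u - w³` and `v' = -v + w³`
  set u : ℝ → ℝ := fun x =>
    Real.exp x * (β * Real.exp (-L) + ∫ y in x..L, Real.exp (-y) * w y ^ 3) with hu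
  set v : ℝ → ℝ := fun x => Real.exp (-x) * (α + ∫ y in (0 : ℝ)..x, Real.exp y * w y ^ 3) with hv
  have hud : ∀ x, HasDerivAt u (u x - w x ^ 3) x := by
    intro x
    have hg : Continuous fun y => Real.exp (-y) * w y ^ 3 := by fun_prop
    have h1 := (intervalIntegral.integral_hasDerivAt_left (hg.intervalIntegrable x L)
      (hg.stronglyMeasurableAtFilter _ _) hg.continuousAt).const_add (β * Real.exp (-L))
    refine ((Real.hasDerivAt_exp x).mul h1).congr_deriv ?_
    have : Real.exp x * Real.exp (-x) = 1 := by rw [← Real.exp_add]; simp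
    linear_combination (-w x ^ 3) * this
  have hvd : ∀ x, HasDerivAt v (-v x + w x ^ 3) x := by
    intro x
    have hg : Continuous fun y => Real.exp y * w y ^ 3 := by fun_prop
    have h1 := (intervalIntegral.integral_hasDerivAt_right (hg.intervalIntegrable 0 x)
      (hg.stronglyMeasurableAtFilter _ _) hg.continuousAt).const_add α
    refine (((hasDerivAt_neg' x).exp).mul h1).congr_deriv ?_
    have : Real.exp (-x) * Real.exp x = 1 := by rw [← Real.exp_add]; simp
    linear_combination (w x ^ 3) * this
  have hd1 : ∀ x, HasDerivAt (fun x => u x + v x) (u x - v x) x := fun x =>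
    ((hud x).add (hvd x)).congr_deriv (by ring)
  have hd2 : ∀ x, HasDerivAt (fun x => u x - v x) (u x + v x - 2 * w x ^ 3) x := fun x =>
    ((hud x).sub (hvd x)).congr_deriv (by ring)
  have hc0 : Continuous fun x => u x + v x :=
    continuous_iff_continuousAt.2 fun x => (hd1 x).continuousAt
  have hc2 : Continuous fun x => u x + v x - 2 * w x ^ 3 := hc0.sub (by fun_prop)
  have huv : ∀ x ∈ Set.Icc 0 L, u x + v x = w x := fun x hx =>
    (edgeSol_stretched hz (fun _ => rfl) hx).symm
  have hode : ∀ x ∈ Set.Icc 0 L, u x + v x - 2 * w x ^ 3 = u x + v x - 2 * (u x + v x) ^ 3 :=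
    fun x hx => by rw [huv x hx]
  have hb : ∀ x ∈ Set.Icc 0 L, |u x + v x| ≤ 1 / 4 := fun x hx => by
    rw [huv x hx]; linarith [hwb x]
  have h0 : (0 : ℝ) ∈ Set.Icc 0 L := ⟨le_rfl, hL.le⟩
  have h1 : L ∈ Set.Icc 0 L := ⟨hL.le, le_rfl⟩
  have hw0 : w 0 = ψ 0 := by simp [hw]
  have hw1 : w L = ψ 1 := by simp [hw, div_self hL.ne']
  have hv0 : v 0 = α := by simp [hv]
  have huL : u L = β := by
    have : Real.exp L * Real.exp (-L) = 1 := by rw [← Real.exp_add]; simp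
    simp only [hu, intervalIntegral.integral_same, add_zero]
    linear_combination β * this
  have hu0 : u 0 = incLeft (α, β, L) := by
    have := huv 0 h0
    rw [hw0, hv0] at this
    simp only [incLeft, ← hψ]; linarith
  have hvL : v L = incRight (α, β, L) := by
    have := huv L h1
    rw [hw1, huL] at this
    simp only [incRight, ← hψ]; linarith
  refine ⟨H2Fun.ofDeriv _ _ _ hd1 hd2 hc2, hode, hb, ?_, ?_, ?_, ?_, ?_⟩
  · change u 0 + v 0 = _
    rw [hv0, hu0]; ring
  · change u L + v L = _
    rw [huL, hvL]
  · change u 0 - v 0 = _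
    rw [hv0, hu0]
  · change u L - v L = _
    rw [huL, hvL]
  · refine (H2Fun.normSq_ofDeriv_le hL.le hd1 hd2 hc2 hode hb).trans ?_
    rw [huv L h1, huv 0 h0]
    have k1 := hwb L
    have k2 := hwb 0
    have k3 : |u L - v L| ≤ 4 * (|α| + |β|) := by
      have e1 : u L - v L = 2 * β - w L := by rw [← huv L h1, huL]; ring
      rw [e1]
      refine (abs_sub _ _).trans ?_
      rw [abs_mul, abs_two]
      linarith [abs_nonneg α]
    have k4 : |u 0 - v 0| ≤ 4 * (|α| + |β|) := by
      have e1 : u 0 - v 0 = w 0 - 2 * α := by rw [← huv 0 h0, hv0]; ring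
      rw [e1]
      refine (abs_sub _ _).trans ?_
      rw [abs_mul, abs_two]
      linarith [abs_nonneg β]
    have k5 : w L * (u L - v L) ≤ 2 * (|α| + |β|) * (4 * (|α| + |β|)) := by
      refine (le_abs_self _).trans ?_
      rw [abs_mul]
      exact mul_le_mul k1 k3 (abs_nonneg _) (by positivity)
    have k6 : -(w 0 * (u 0 - v 0)) ≤ 2 * (|α| + |β|) * (4 * (|α| + |β|)) := by
      refine (neg_le_abs _).trans ?_
      rw [abs_mul]
      exact mul_le_mul k2 k4 (abs_nonneg _) (by positivity)
    linarith

/-- The solution of the nonlinear equation on a half-line, `ψ(x) = 2 a e⁻ˣ / (1 + a² e⁻²ˣ)`, which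
is a translate of `± sech`. -/
theorem exists_H2Fun_ray {c : ℝ} (hc : |c| < 1 / 16) :
    ∃ f : H2Fun (Set.Ici 0),
      (∀ x, f.d2 x = f.val x - 2 * f.val x ^ 3) ∧
      (∀ x ∈ Set.Ici (0 : ℝ), |f.val x| ≤ 1 / 4) ∧
      f.val 0 = c ∧ f.d1 0 = rayDefect c - c ∧ f.normSq ≤ 6 * c ^ 2 := by
  have hc2 : c ^ 2 ≤ 1 / 256 := by
    have := sq_lt_sq' (abs_lt.1 hc).1 (abs_lt.1 hc).2
    norm_num at this; linarith
  set s := Real.sqrt (1 - c ^ 2) with hs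
  have hs2 : s ^ 2 = 1 - c ^ 2 := Real.sq_sqrt (by linarith)
  have hs0 : 0 ≤ s := Real.sqrt_nonneg _
  set a := c / (1 + s) with ha
  have hac : a * (1 + s) = c := div_mul_cancel₀ _ (by positivity)
  have haa : a ^ 2 * (1 + s) = 1 - s := by
    have h1 : (1 + s) ≠ 0 := by positivity
    rw [ha, div_pow]; field_simp; linarith
  have hale : |a| ≤ |c| := by
    rw [ha, abs_div, abs_of_pos (by positivity : 0 < 1 + s)]
    exact div_le_self (abs_nonneg _) (by linarith)
  have ha2 : a ^ 2 ≤ c ^ 2 := sq_le_sq.2 hale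
  clear_value a
  have hca : c * (1 + a ^ 2) = 2 * a := by linear_combination a * haa - (1 + a ^ 2) * hac
  have hsa : s * (1 + a ^ 2) = 1 - a ^ 2 := by linear_combination haa
  set D : ℝ → ℝ := fun x => 1 + a ^ 2 * Real.exp (-x) ^ 2 with hD
  have hDpos : ∀ x, 0 < D x := fun x => by simp only [hD]; positivity
  have hD1 : ∀ x, 1 ≤ D x := fun x => by
    simp only [hD]; have := mul_nonneg (sq_nonneg a) (sq_nonneg (Real.exp (-x))); linarith
  set f : ℝ → ℝ := fun x => 2 * a * Real.exp (-x) / D x with hf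
  set f' : ℝ → ℝ := fun x =>
    -(2 * a * Real.exp (-x) * (1 - a ^ 2 * Real.exp (-x) ^ 2)) / D x ^ 2 with hf'
  have hE : ∀ x : ℝ, HasDerivAt (fun x => Real.exp (-x)) (-Real.exp (-x)) x := fun x =>
    ((hasDerivAt_neg' x).exp).congr_deriv (by ring)
  have hE2 : ∀ x : ℝ, HasDerivAt (fun x => a ^ 2 * Real.exp (-x) ^ 2)
      (-(2 * a ^ 2 * Real.exp (-x) ^ 2)) x := fun x =>
    (((hE x).fun_pow 2).const_mul (a ^ 2)).congr_deriv (by push_cast; ring)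
  have hDd : ∀ x : ℝ, HasDerivAt D (-(2 * a ^ 2 * Real.exp (-x) ^ 2)) x := fun x =>
    (hE2 x).const_add 1
  have hd1 : ∀ x, HasDerivAt f (f' x) x := fun x => by
    refine (((hE x).const_mul (2 * a)).div (hDd x) (hDpos x).ne').congr_deriv ?_
    simp only [hf']
    congr 1
    simp only [hD]; ring
  have hd2 : ∀ x, HasDerivAt f' (f x - 2 * f x ^ 3) x := fun x => by
    have h1 := ((((hE x).const_mul (2 * a)).mul ((hE2 x).const_sub 1)).neg).div
      ((hDd x).fun_pow 2) (pow_ne_zero 2 (hDpos x).ne')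
    refine h1.congr_deriv ?_
    have hne := (hDpos x).ne'
    simp only [hf, Pi.neg_apply, Pi.mul_apply]
    rw [div_pow]
    field_simp
    simp only [hD]
    push_cast
    ring
  have hc0 : Continuous f := continuous_iff_continuousAt.2 fun x => (hd1 x).continuousAt
  have hc1 : Continuous f' := continuous_iff_continuousAt.2 fun x => (hd2 x).continuousAt
  have hcc2 : Continuous fun x => f x - 2 * f x ^ 3 := by fun_prop
  have hb0 : ∀ x, |f x| ≤ 2 * |a| * Real.exp (-x) := fun x => by
    simp only [hf]
    rw [abs_div, abs_of_pos (hDpos x), abs_mul, abs_mul, abs_two, abs_of_pos (Real.exp_pos _)]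
    exact div_le_self (by positivity) (hD1 x)
  have hb1 : ∀ x, |f' x| ≤ 2 * |a| * Real.exp (-x) := fun x => by
    have h1 : |1 - a ^ 2 * Real.exp (-x) ^ 2| ≤ D x ^ 2 := by
      have h2 : |1 - a ^ 2 * Real.exp (-x) ^ 2| ≤ D x := by
        have := mul_nonneg (sq_nonneg a) (sq_nonneg (Real.exp (-x)))
        simp only [hD]
        rw [abs_le]; constructor <;> linarith
      refine h2.trans ?_
      have := hD1 x
      nlinarith
    simp only [hf']
    rw [abs_div, abs_neg, abs_mul, abs_mul, abs_mul, abs_two, abs_of_pos (Real.exp_pos _),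
      abs_of_pos (pow_pos (hDpos x) 2), div_le_iff₀ (pow_pos (hDpos x) 2)]
    exact mul_le_mul_of_nonneg_left h1 (by positivity)
  have hfq : ∀ x ∈ Set.Ici (0 : ℝ), |f x| ≤ 1 / 4 := fun x hx => by
    have h1 : Real.exp (-x) ≤ 1 := Real.exp_le_one_iff.2 (neg_nonpos.2 hx)
    have h2 := mul_le_mul_of_nonneg_left h1 (by positivity : 0 ≤ 2 * |a|)
    linarith [hb0 x]
  have hb2 : ∀ x ∈ Set.Ici (0 : ℝ), |f x - 2 * f x ^ 3| ≤ 2 * |a| * Real.exp (-x) :=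
    fun x hx => by
      have h1 : f x - 2 * f x ^ 3 = f x * (1 - 2 * f x ^ 2) := by ring
      have h3 : f x ^ 2 ≤ 1 / 16 := by
        rw [← sq_abs]
        calc |f x| ^ 2 ≤ (1 / 4) ^ 2 := pow_le_pow_left₀ (abs_nonneg _) (hfq x hx) 2
          _ = 1 / 16 := by norm_num
      rw [h1, abs_mul]
      refine (mul_le_of_le_one_right (abs_nonneg _) ?_).trans (hb0 x)
      rw [abs_le]
      constructor <;> nlinarith [sq_nonneg (f x)]
  set g : ℝ → ℝ := fun x => 2 * |a| * Real.exp (-x) with hg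
  have hgsq : ∀ x, g x ^ 2 = 4 * a ^ 2 * Real.exp (-2 * x) := fun x => by
    simp only [hg]
    rw [mul_pow, mul_pow, sq_abs, ← Real.exp_nat_mul]
    push_cast
    ring_nf
  have hgi : IntegrableOn (fun x => g x ^ 2) (Set.Ici 0) := by
    simp only [hgsq]
    rw [integrableOn_Ici_iff_integrableOn_Ioi]
    exact (integrableOn_exp_mul_Ioi (by norm_num : (-2 : ℝ) < 0) 0).const_mul _
  have hgint : ∫ x in Set.Ici (0 : ℝ), g x ^ 2 = 2 * a ^ 2 := by
    simp only [hgsq]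
    rw [integral_Ici_eq_integral_Ioi, integral_const_mul, integral_exp_mul_Ioi (by norm_num)]
    norm_num
    ring
  have hgL : MemLp g 2 (volume.restrict (Set.Ici 0)) := by
    rw [memLp_two_iff_integrable_sq (by
      have : Continuous g := by fun_prop
      exact this.aestronglyMeasurable)]
    exact hgi
  have hLp : ∀ h : ℝ → ℝ, Continuous h → (∀ x ∈ Set.Ici (0 : ℝ), |h x| ≤ g x) →
      MemLp h 2 (volume.restrict (Set.Ici 0)) := fun h hcont hh =>
    hgL.mono hcont.aestronglyMeasurable <| by
      filter_upwards [ae_restrict_mem measurableSet_Ici] with x hx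
      exact (hh x hx).trans (le_abs_self _)
  have hle : ∀ h : ℝ → ℝ, Continuous h → (∀ x ∈ Set.Ici (0 : ℝ), |h x| ≤ g x) →
      ∫ x in Set.Ici (0 : ℝ), h x ^ 2 ≤ 2 * a ^ 2 := fun h hcont hh => by
    rw [← hgint]
    refine setIntegral_mono_on ((memLp_two_iff_integrable_sq hcont.aestronglyMeasurable).1
      (hLp h hcont hh)) hgi measurableSet_Ici fun x hx => ?_
    rw [← sq_abs (h x)]
    exact pow_le_pow_left₀ (abs_nonneg _) (hh x hx) 2
  refine ⟨⟨f, f', fun x => f x - 2 * f x ^ 3, hLp _ hc0 fun x _ => hb0 x,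
    hLp _ hc1 fun x _ => hb1 x, hLp _ hcc2 hb2, fun x _ => ?_, fun x _ => ?_⟩, fun x => rfl, hfq,
    ?_, ?_, ?_⟩
  · rw [intervalIntegral.integral_eq_sub_of_hasDerivAt (fun y _ => hd1 y)
      (hc1.intervalIntegrable _ _)]
    ring
  · rw [intervalIntegral.integral_eq_sub_of_hasDerivAt (fun y _ => hd2 y)
      (hcc2.intervalIntegrable _ _)]
    ring
  · simp only [hf, hD, neg_zero, Real.exp_zero, mul_one, one_pow]
    rw [div_eq_iff (by positivity)]
    exact hca.symm
  · simp only [hf', hD, neg_zero, Real.exp_zero, mul_one, one_pow, rayDefect]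
    rw [div_eq_iff (by positivity), ← hs]
    linear_combination s * (1 + a ^ 2) * hca + 2 * a * hsa
  · have k0 := hle f hc0 fun x _ => hb0 x
    have k1 := hle f' hc1 fun x _ => hb1 x
    have k2 := hle _ hcc2 hb2
    change (∫ x in Set.Ici (0 : ℝ), f x ^ 2) + (∫ x in Set.Ici (0 : ℝ), f' x ^ 2)
      + ∫ x in Set.Ici (0 : ℝ), (f x - 2 * f x ^ 3) ^ 2 ≤ _
    linarith

end

/-! ### Regularity, the maximum principle and uniqueness -/

noncomputable section

open Filter Topology Set

/-- A classical solution of `-ψ'' + ψ = 2 ψ³` on an interval. -/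
structure H2Fun.IsClassical {I : Set ℝ} (f : H2Fun I) : Prop where
  cont_val : ContinuousOn f.val I
  cont_d1 : ContinuousOn f.d1 I
  deriv_val : ∀ x ∈ interior I, HasDerivAt f.val (f.d1 x) x
  deriv_d1 : ∀ x ∈ interior I, HasDerivAt f.d1 (f.val x - 2 * f.val x ^ 3) x

/-- A primitive in the sense of absolute continuity is continuous, and differentiable where the
integrand is continuous. -/
theorem continuousOn_and_hasDerivAt_of_primitive {L : ℝ} (hL : 0 ≤ L) {F g : ℝ → ℝ}
    (hg : IntegrableOn g (Icc 0 L)) (hF : ∀ x ∈ Icc 0 L, F x = F 0 + ∫ t in (0 : ℝ)..x, g t) :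
    ContinuousOn F (Icc 0 L) ∧
      (ContinuousOn g (Icc 0 L) → ∀ x ∈ Ioo 0 L, HasDerivAt F (g x) x) := by
  have hg' : IntegrableOn g (uIcc 0 L) := by rwa [uIcc_of_le hL]
  constructor
  · have h := intervalIntegral.continuousOn_primitive_interval hg'
    rw [uIcc_of_le hL] at h
    exact (continuousOn_const.add h).congr hF
  · intro hgc x hx
    have hmem : Ioo 0 L ∈ 𝓝 x := isOpen_Ioo.mem_nhds hx
    have hgo : ContinuousOn g (Ioo 0 L) := hgc.mono Ioo_subset_Icc_self
    have hi : IntervalIntegrable g volume 0 x := by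
      rw [intervalIntegrable_iff_integrableOn_Icc_of_le hx.1.le]
      exact hg.mono_set (Icc_subset_Icc_right hx.2.le)
    have h := (intervalIntegral.integral_hasDerivAt_right hi
      (hgo.stronglyMeasurableAtFilter isOpen_Ioo x hx) (hgo.continuousAt hmem)).const_add (F 0)
    refine h.congr_of_eventuallyEq ?_
    filter_upwards [hmem] with y hy using hF y (Ioo_subset_Icc_self hy)

theorem H2Fun.isClassical_Icc {L : ℝ} (hL : 0 ≤ L) (f : H2Fun (Icc 0 L))
    (hf : ∀ᵐ z ∂volume.restrict (Icc 0 L), -f.d2 z + f.val z = 2 * |f.val z| ^ 2 * f.val z) :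
    f.IsClassical := by
  have hint : ∀ g : ℝ → ℝ, MemLp g 2 (volume.restrict (Icc 0 L)) → IntegrableOn g (Icc 0 L) :=
    fun g hg => hg.integrable (by norm_num)
  have h1 := continuousOn_and_hasDerivAt_of_primitive hL (hint _ f.memLp_d1) f.val_eq
  have h2 := continuousOn_and_hasDerivAt_of_primitive hL (hint _ f.memLp_d2) f.d1_eq
  have hc : ContinuousOn (fun x => f.val x - 2 * f.val x ^ 3) (Icc 0 L) := by
    have := h1.1
    fun_prop
  have hae : ∀ᵐ z ∂volume.restrict (Icc 0 L), f.d2 z = f.val z - 2 * f.val z ^ 3 := by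
    filter_upwards [hf] with z hz
    rw [sq_abs] at hz
    linear_combination -hz
  have h3 := continuousOn_and_hasDerivAt_of_primitive hL (F := f.d1)
    (hc.integrableOn_compact isCompact_Icc) fun x hx => by
      rw [f.d1_eq x hx]
      congr 1
      refine intervalIntegral.integral_congr_ae ?_
      rw [uIoc_of_le hx.1]
      have h4 := (ae_restrict_iff' measurableSet_Icc).1 hae
      filter_upwards [h4] with z hz hzx
      exact hz ⟨hzx.1.le, hzx.2.trans hx.2⟩
  exact ⟨h1.1, h2.1, fun x hx => h1.2 h2.1 x (by rwa [interior_Icc] at hx),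
    fun x hx => h3.2 hc x (by rwa [interior_Icc] at hx)⟩

/-- The restriction of a function on the half-line to a bounded interval. -/
def H2Fun.restrict (f : H2Fun (Ici 0)) (R : ℝ) : H2Fun (Icc 0 R) where
  val := f.val
  d1 := f.d1
  d2 := f.d2
  memLp_val := f.memLp_val.mono_measure (Measure.restrict_mono Icc_subset_Ici_self le_rfl)
  memLp_d1 := f.memLp_d1.mono_measure (Measure.restrict_mono Icc_subset_Ici_self le_rfl)
  memLp_d2 := f.memLp_d2.mono_measure (Measure.restrict_mono Icc_subset_Ici_self le_rfl)
  val_eq x hx := f.val_eq x hx.1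
  d1_eq x hx := f.d1_eq x hx.1

theorem H2Fun.isClassical_Ici (f : H2Fun (Ici 0))
    (hf : ∀ᵐ z ∂volume.restrict (Ici (0 : ℝ)),
      -f.d2 z + f.val z = 2 * |f.val z| ^ 2 * f.val z) :
    f.IsClassical := by
  have hR : ∀ R : ℝ, 0 ≤ R → (f.restrict R).IsClassical := fun R hR =>
    (f.restrict R).isClassical_Icc hR
      (ae_mono (Measure.restrict_mono Icc_subset_Ici_self le_rfl) hf)
  have hcont : ∀ g : ℝ → ℝ, (∀ R, 0 ≤ R → ContinuousOn g (Icc 0 R)) → ContinuousOn g (Ici 0) := by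
    intro g hg x hx
    have h := hg (x + 1) (by linarith [mem_Ici.1 hx]) x ⟨hx, by linarith⟩
    refine h.mono_of_mem_nhdsWithin ?_
    rw [← Ici_inter_Iic]
    exact inter_mem_nhdsWithin _ (Iic_mem_nhds (by linarith))
  refine ⟨hcont _ fun R h => (hR R h).cont_val, hcont _ fun R h => (hR R h).cont_d1,
    fun x hx => ?_, fun x hx => ?_⟩ <;> rw [interior_Ici, mem_Ioi] at hx
  · exact (hR (x + 1) (by linarith)).deriv_val x (by rw [interior_Icc]; constructor <;> linarith)
  · exact (hR (x + 1) (by linarith)).deriv_d1 x (by rw [interior_Icc]; constructor <;> linarith)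

/-- If a function and its derivative are square integrable on a half-line, then the function
vanishes at infinity. -/
theorem tendsto_zero_of_memLp_two {f f' : ℝ → ℝ} (hd : ∀ x ∈ Ioi (0 : ℝ), HasDerivAt f (f' x) x)
    (hf : MemLp f 2 (volume.restrict (Ioi 0))) (hf' : MemLp f' 2 (volume.restrict (Ioi 0))) :
    Tendsto f atTop (𝓝 0) := by
  have h1 : Tendsto (fun x => f x ^ 2) atTop (𝓝 0) := by
    refine tendsto_zero_of_hasDerivAt_of_integrableOn_Ioi (a := 0)
      (f' := fun x => 2 * (f x * f' x)) (fun x hx => ?_) ?_ ?_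
    · refine ((hd x hx).fun_pow 2).congr_deriv ?_
      push_cast; ring
    · exact (hf.integrable_mul hf').const_mul 2
    · exact (memLp_two_iff_integrable_sq hf.aestronglyMeasurable).1 hf
  have h2 := h1.sqrt
  simp only [Real.sqrt_sq_eq_abs, Real.sqrt_zero] at h2
  exact (tendsto_zero_iff_abs_tendsto_zero f).2 h2

theorem H2Fun.tendsto_zero (f : H2Fun (Ici 0))
    (hf : ∀ᵐ z ∂volume.restrict (Ici (0 : ℝ)),
      -f.d2 z + f.val z = 2 * |f.val z| ^ 2 * f.val z) :
    Tendsto f.val atTop (𝓝 0) ∧ Tendsto f.d1 atTop (𝓝 0) := by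
  have hc := f.isClassical_Ici hf
  have hd1 := hc.deriv_val
  have hd2 := hc.deriv_d1
  rw [interior_Ici] at hd1 hd2
  have hL : ∀ g : ℝ → ℝ, MemLp g 2 (volume.restrict (Ici 0)) →
      MemLp g 2 (volume.restrict (Ioi 0)) := fun g hg =>
    hg.mono_measure (Measure.restrict_mono Ioi_subset_Ici_self le_rfl)
  refine ⟨tendsto_zero_of_memLp_two hd1 (hL _ f.memLp_val) (hL _ f.memLp_d1),
    tendsto_zero_of_memLp_two hd2 (hL _ f.memLp_d1) (hL _ ?_)⟩
  refine f.memLp_d2.ae_eq ?_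
  filter_upwards [hf] with z hz
  rw [sq_abs] at hz
  linear_combination -hz

theorem eq_zero_of_monotone_Icc {L : ℝ} (hL : 0 ≤ L) {G g : ℝ → ℝ} (hc : ContinuousOn G (Icc 0 L))
    (hd : ∀ x ∈ Ioo 0 L, HasDerivAt G (g x) x) (hg : ∀ x ∈ Ioo 0 L, 0 ≤ g x) :
    G 0 ≤ G L ∧ (G L ≤ G 0 → ∀ x ∈ Ioo 0 L, g x = 0) := by
  have hmono : MonotoneOn G (Icc 0 L) := by
    refine monotoneOn_of_hasDerivWithinAt_nonneg (convex_Icc 0 L) hc (f' := g) ?_ ?_ <;>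
      rw [interior_Icc]
    exacts [fun x hx => (hd x hx).hasDerivWithinAt, hg]
  have h0 : (0 : ℝ) ∈ Icc 0 L := ⟨le_rfl, hL⟩
  have h1 : L ∈ Icc 0 L := ⟨hL, le_rfl⟩
  refine ⟨hmono h0 h1 hL, fun hle x hx => ?_⟩
  refine (hd x hx).unique ((hasDerivAt_const x (G 0)).congr_of_eventuallyEq ?_)
  filter_upwards [isOpen_Ioo.mem_nhds hx] with y hy
  have hy' := Ioo_subset_Icc_self hy
  exact le_antisymm ((hmono hy' h1 hy.2.le).trans hle) (hmono h0 hy' hy.1.le)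

theorem eq_zero_of_monotone_Ici {G g : ℝ → ℝ} (hc : ContinuousOn G (Ici 0))
    (hd : ∀ x ∈ Ioi (0 : ℝ), HasDerivAt G (g x) x) (hg : ∀ x ∈ Ioi (0 : ℝ), 0 ≤ g x)
    (hlim : Tendsto G atTop (𝓝 0)) :
    G 0 ≤ 0 ∧ (0 ≤ G 0 → ∀ x ∈ Ioi (0 : ℝ), g x = 0) := by
  have hmono : MonotoneOn G (Ici 0) := by
    refine monotoneOn_of_hasDerivWithinAt_nonneg (convex_Ici 0) hc (f' := g) ?_ ?_ <;>
      rw [interior_Ici]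
    exacts [fun x hx => (hd x hx).hasDerivWithinAt, hg]
  have hle : ∀ x ∈ Ici (0 : ℝ), G x ≤ 0 := fun x hx =>
    ge_of_tendsto hlim <| by
      filter_upwards [eventually_ge_atTop x] with y hy using hmono hx (le_trans hx hy) hy
  refine ⟨hle 0 self_mem_Ici, fun h0 x hx => ?_⟩
  refine (hd x hx).unique ((hasDerivAt_const x (0 : ℝ)).congr_of_eventuallyEq ?_)
  filter_upwards [isOpen_Ioi.mem_nhds hx] with y hy
  have hy' : y ∈ Ici (0 : ℝ) := Ioi_subset_Ici_self hy
  exact le_antisymm (hle y hy') (h0.trans (hmono self_mem_Ici hy' hy'))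

namespace MetricGraph

variable {V E H : Type*} [Fintype E] [Fintype H]

/-- Functions on the edges of a graph whose derivatives are nonnegative, with no net flux: all
derivatives vanish. -/
theorem eq_zero_of_sum_le {Γ : MetricGraph V E H} {μ : ℝ} (hμ : 0 < μ) {G g : E → ℝ → ℝ}
    {K k : H → ℝ → ℝ} (hGc : ∀ e, ContinuousOn (G e) (Icc 0 (μ * Γ.len e)))
    (hGd : ∀ e, ∀ x ∈ Ioo 0 (μ * Γ.len e), HasDerivAt (G e) (g e x) x)
    (hg : ∀ e, ∀ x ∈ Ioo 0 (μ * Γ.len e), 0 ≤ g e x)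
    (hKc : ∀ h, ContinuousOn (K h) (Ici 0))
    (hKd : ∀ h, ∀ x ∈ Ioi (0 : ℝ), HasDerivAt (K h) (k h x) x)
    (hk : ∀ h, ∀ x ∈ Ioi (0 : ℝ), 0 ≤ k h x) (hKlim : ∀ h, Tendsto (K h) atTop (𝓝 0))
    (hsum : ∑ e, (G e (μ * Γ.len e) - G e 0) - ∑ h, K h 0 = 0) :
    (∀ e, ∀ x ∈ Ioo 0 (μ * Γ.len e), g e x = 0) ∧ ∀ h, ∀ x ∈ Ioi (0 : ℝ), k h x = 0 := by
  have hE := fun e => eq_zero_of_monotone_Icc (mul_pos hμ (Γ.len_pos e)).le (hGc e) (hGd e) (hg e)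
  have hH := fun h => eq_zero_of_monotone_Ici (hKc h) (hKd h) (hk h) (hKlim h)
  have h1 : ∀ e ∈ Finset.univ, 0 ≤ G e (μ * Γ.len e) - G e 0 := fun e _ => sub_nonneg.2 (hE e).1
  have h2 : ∀ h ∈ Finset.univ, 0 ≤ -K h 0 := fun h _ => neg_nonneg.2 (hH h).1
  have h3 : ∑ e, (G e (μ * Γ.len e) - G e 0) + ∑ h, -K h 0 = 0 := by
    rw [Finset.sum_neg_distrib, ← sub_eq_add_neg, hsum]
  have h4 := (add_eq_zero_iff_of_nonneg (Finset.sum_nonneg h1) (Finset.sum_nonneg h2)).1 h3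
  rw [Finset.sum_eq_zero_iff_of_nonneg h1, Finset.sum_eq_zero_iff_of_nonneg h2] at h4
  exact ⟨fun e => (hE e).2 (sub_nonpos.1 (h4.1 e (Finset.mem_univ e)).le),
    fun h => (hH h).2 (neg_nonpos.1 (h4.2 h (Finset.mem_univ h)).le)⟩

theorem sum_mul_sum_fiber {κ : Type*} [Fintype V] [DecidableEq V] [Fintype κ] (φ : V → ℝ)
    (t : κ → V) (w : κ → ℝ) : ∑ v, φ v * ∑ i with t i = v, w i = ∑ i, φ (t i) * w i := by
  rw [← Finset.sum_fiberwise Finset.univ t]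
  refine Finset.sum_congr rfl fun v _ => ?_
  rw [Finset.mul_sum]
  refine Finset.sum_congr rfl fun i hi => ?_
  rw [(Finset.mem_filter.1 hi).2]

/-- Summation by parts over the edge ends of a graph. -/
theorem H2.sum_mul_flux [Fintype V] [DecidableEq V] {Γ : MetricGraph V E H} {μ : ℝ} (Ψ : Γ.H2 μ)
    (φ : V → ℝ) :
    ∑ v, φ v * Ψ.flux v
    = ∑ e, (φ (Γ.tgt e) * (Ψ.onEdge e).d1 (μ * Γ.len e) - φ (Γ.src e) * (Ψ.onEdge e).d1 0)
      - ∑ h, φ (Γ.base h) * (Ψ.onRay h).d1 0 := by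
  simp only [H2.flux, mul_add, Finset.sum_add_distrib]
  rw [sum_mul_sum_fiber, sum_mul_sum_fiber, sum_mul_sum_fiber, Finset.sum_sub_distrib]
  simp only [mul_neg, Finset.sum_neg_distrib]
  ring

variable [DecidableEq V]

/-- A solution of the boundary value problem has a single value at each vertex; it satisfies the
Kirchhoff condition outside the boundary. -/
theorem H2.SolvesBVP.exists_values {Γ : MetricGraph V E H} {μ : ℝ} {Ψ : Γ.H2 μ} {B : Finset V}
    {p : EuclideanSpace ℝ B} (h : Ψ.SolvesBVP B p) :
    ∃ c : V → ℝ, (∀ v, Ψ.HasValueAt v (c v)) ∧ (∀ j : B, c j = p j) ∧ ∀ v, v ∉ B → Ψ.flux v = 0 := by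
  have : ∀ v, ∃ c, Ψ.HasValueAt v c ∧ ∀ j : B, (j : V) = v → c = p j := by
    intro v
    by_cases hv : v ∈ B
    · exact ⟨p ⟨v, hv⟩, h.2.2 ⟨v, hv⟩, fun j hj => by subst hj; rfl⟩
    · obtain ⟨c, hc⟩ := (h.2.1 v hv).1
      exact ⟨c, hc, fun j hj => absurd (hj ▸ j.2) hv⟩
  choose c hc using this
  exact ⟨c, fun v => (hc v).1, fun j => (hc j).2 j rfl, fun v hv => (h.2.1 v hv).2⟩

theorem hasDerivAt_max_zero_sq (u : ℝ) :
    HasDerivAt (fun u : ℝ => max u 0 ^ 2) (2 * max u 0) u := by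
  rcases lt_trichotomy u 0 with hu | rfl | hu
  · rw [max_eq_right hu.le, mul_zero]
    refine (hasDerivAt_const u (0 : ℝ)).congr_of_eventuallyEq ?_
    filter_upwards [Iio_mem_nhds hu] with y hy
    rw [max_eq_right (le_of_lt hy)]; norm_num
  · rw [max_self, mul_zero, hasDerivAt_iff_isLittleO]
    simp only [max_self, sub_zero, smul_zero, ne_eq, OfNat.ofNat_ne_zero, not_false_eq_true,
      zero_pow]
    refine Asymptotics.IsBigO.trans_isLittleO (g := fun x : ℝ => x ^ 2) ?_
      (Asymptotics.isLittleO_pow_id one_lt_two)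
    refine Asymptotics.isBigO_of_le _ fun x => ?_
    rw [norm_pow, norm_pow, Real.norm_eq_abs, Real.norm_eq_abs]
    refine pow_le_pow_left₀ (abs_nonneg _) ?_ 2
    rw [abs_of_nonneg (le_max_right _ _)]
    exact max_le (le_abs_self x) (abs_nonneg x)
  · rw [max_eq_left hu.le]
    refine ((hasDerivAt_pow 2 u).congr_of_eventuallyEq ?_).congr_deriv (by push_cast; ring)
    filter_upwards [Ioi_mem_nhds hu] with y hy
    rw [max_eq_left (le_of_lt hy)]

/-- **Maximum principle.** A multiple `σ Ψ` of the solution is bounded by any nonnegative bound for its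
boundary values. -/
theorem H2.SolvesBVP.le_of_boundary_le [Fintype V] {Γ : MetricGraph V E H} {μ : ℝ} (hμ : 0 < μ) {Ψ : Γ.H2 μ}
    {B : Finset V} {p : EuclideanSpace ℝ B} (h : Ψ.SolvesBVP B p)
    (hb : Ψ.Everywhere fun y => |y| < 1 / Real.sqrt 2) {σ M : ℝ} (hM : 0 ≤ M)
    (hp : ∀ j, σ * p j ≤ M) : Ψ.Everywhere fun y => σ * y ≤ M := by
  obtain ⟨c, hval, hcp, hflux⟩ := h.exists_values
  have hcE := fun e => (Ψ.onEdge e).isClassical_Icc (mul_pos hμ (Γ.len_pos e)).le (h.1.1 e)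
  have hcH := fun k => (Ψ.onRay k).isClassical_Ici (h.1.2 k)
  -- test the equation with the square of the positive part of `σ Ψ - M`
  set φ : ℝ → ℝ := fun y => max (σ * y - M) 0 ^ 2 with hφ
  have hφc : Continuous φ := by simp only [hφ]; fun_prop
  set G : (ℝ → ℝ) → (ℝ → ℝ) → ℝ → ℝ := fun f f' x => φ (f x) * (σ * f' x) with hG
  set g : (ℝ → ℝ) → (ℝ → ℝ) → ℝ → ℝ := fun f f' x =>
    2 * max (σ * f x - M) 0 * (σ * f' x) ^ 2
      + max (σ * f x - M) 0 ^ 2 * ((σ * f x) * (1 - 2 * f x ^ 2)) with hg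
  have hGd : ∀ (f f' : ℝ → ℝ) (x : ℝ), HasDerivAt f (f' x) x →
      HasDerivAt f' (f x - 2 * f x ^ 3) x → HasDerivAt (G f f') (g f f' x) x := by
    intro f f' x h1 h2
    have h3 : HasDerivAt (fun x => φ (f x)) (2 * max (σ * f x - M) 0 * (σ * f' x)) x :=
      HasDerivAt.comp (h₂ := fun u : ℝ => max u 0 ^ 2) x
        (hasDerivAt_max_zero_sq (σ * f x - M)) ((h1.const_mul σ).sub_const M)
    refine (h3.mul (h2.const_mul σ)).congr_deriv ?_
    simp only [hg, hφ]
    ring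
  have hg0 : ∀ (f f' : ℝ → ℝ) (x : ℝ), |f x| < 1 / Real.sqrt 2 →
      0 ≤ g f f' x ∧ (g f f' x = 0 → σ * f x ≤ M) := by
    intro f f' x hx
    have h1 : f x ^ 2 < 1 / 2 := by
      rw [← sq_abs]
      calc |f x| ^ 2 < (1 / Real.sqrt 2) ^ 2 := pow_lt_pow_left₀ hx (abs_nonneg _) two_ne_zero
        _ = 1 / 2 := by rw [div_pow, Real.sq_sqrt (by norm_num)]; norm_num
    have h0 : 0 ≤ 2 * max (σ * f x - M) 0 * (σ * f' x) ^ 2 := by positivity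
    simp only [hg]
    rcases le_or_gt (σ * f x) M with h2 | h2
    · rw [max_eq_right (by linarith)]
      simp [h2]
    · have h3 : 0 < max (σ * f x - M) 0 := lt_max_of_lt_left (by linarith)
      have h4 : 0 < max (σ * f x - M) 0 ^ 2 * ((σ * f x) * (1 - 2 * f x ^ 2)) :=
        mul_pos (pow_pos h3 2) (mul_pos (by linarith) (by linarith))
      exact ⟨by linarith, fun h5 => by linarith⟩
  have hsum : ∑ e, (G (Ψ.onEdge e).val (Ψ.onEdge e).d1 (μ * Γ.len e)
      - G (Ψ.onEdge e).val (Ψ.onEdge e).d1 0)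
      - ∑ k, G (Ψ.onRay k).val (Ψ.onRay k).d1 0 = 0 := by
    have h1 := Ψ.sum_mul_flux fun v => σ * φ (c v)
    have h2 : ∀ v, (σ * φ (c v)) * Ψ.flux v = 0 := by
      intro v
      by_cases hv : v ∈ B
      · have h3 : c v = p ⟨v, hv⟩ := hcp ⟨v, hv⟩
        have h4 := hp ⟨v, hv⟩
        simp only [hφ]
        rw [h3, max_eq_right (by linarith)]
        ring
      · rw [hflux v hv, mul_zero]
    rw [Finset.sum_eq_zero fun v _ => h2 v] at h1
    refine Eq.trans ?_ h1.symm
    congr 1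
    · refine Finset.sum_congr rfl fun e _ => ?_
      simp only [hG]
      rw [(hval _).1 e rfl, (hval _).2.1 e rfl]
      ring
    · refine Finset.sum_congr rfl fun k _ => ?_
      simp only [hG]
      rw [(hval _).2.2 k rfl]
      ring
  have hz := eq_zero_of_sum_le (Γ := Γ) hμ
    (G := fun e => G (Ψ.onEdge e).val (Ψ.onEdge e).d1)
    (g := fun e => g (Ψ.onEdge e).val (Ψ.onEdge e).d1)
    (K := fun k => G (Ψ.onRay k).val (Ψ.onRay k).d1)
    (k := fun k => g (Ψ.onRay k).val (Ψ.onRay k).d1)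
    (fun e => (hφc.comp_continuousOn (hcE e).cont_val).mul (continuousOn_const.mul (hcE e).cont_d1))
    (fun e x hx => by
      rw [← interior_Icc] at hx
      exact hGd _ _ x ((hcE e).deriv_val x hx) ((hcE e).deriv_d1 x hx))
    (fun e x hx => (hg0 _ _ x (hb.1 e x (Ioo_subset_Icc_self hx))).1)
    (fun k => (hφc.comp_continuousOn (hcH k).cont_val).mul (continuousOn_const.mul (hcH k).cont_d1))
    (fun k x hx => by
      rw [← interior_Ici] at hx
      exact hGd _ _ x ((hcH k).deriv_val x hx) ((hcH k).deriv_d1 x hx))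
    (fun k x hx => (hg0 _ _ x (hb.2 k x (Ioi_subset_Ici_self hx))).1)
    (fun k => by
      have ht := (Ψ.onRay k).tendsto_zero (h.1.2 k)
      have h1 := ((hφc.tendsto 0).comp ht.1).mul (ht.2.const_mul σ)
      simpa using h1) hsum
  constructor
  · intro e z hz'
    have hpos := mul_pos hμ (Γ.len_pos e)
    refine le_on_closure (s := Ioo 0 (μ * Γ.len e)) (f := fun x => σ * (Ψ.onEdge e).val x)
      (g := fun _ => M) (fun x hx => (hg0 _ _ x (hb.1 e x (Ioo_subset_Icc_self hx))).2
        (hz.1 e x hx)) ?_ continuousOn_const ?_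
    · rw [closure_Ioo hpos.ne]
      exact continuousOn_const.mul (hcE e).cont_val
    · rwa [closure_Ioo hpos.ne]
  · intro k z hz'
    refine le_on_closure (s := Ioi (0 : ℝ)) (f := fun x => σ * (Ψ.onRay k).val x)
      (g := fun _ => M) (fun x hx => (hg0 _ _ x (hb.2 k x (Ioi_subset_Ici_self hx))).2
        (hz.2 k x hx)) ?_ continuousOn_const ?_
    · rw [closure_Ioi]
      exact continuousOn_const.mul (hcH k).cont_val
    · rwa [closure_Ioi]

/-- Two small solutions of the boundary value problem with the same boundary data coincide: the
energy of their difference vanishes. -/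
theorem H2.SolvesBVP.same_of_small [Fintype V] {Γ : MetricGraph V E H} {μ : ℝ} (hμ : 0 < μ) {Ψ Φ : Γ.H2 μ}
    {B : Finset V} {p : EuclideanSpace ℝ B} (hΨ : Ψ.SolvesBVP B p) (hΦ : Φ.SolvesBVP B p)
    (hbΨ : Ψ.Everywhere fun y => |y| ≤ 1 / 4) (hbΦ : Φ.Everywhere fun y => |y| ≤ 1 / 4) :
    Ψ.Same Φ := by
  obtain ⟨c, hval, hcp, hflux⟩ := hΨ.exists_values
  obtain ⟨c', hval', hcp', hflux'⟩ := hΦ.exists_values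
  have hcE := fun e => (Ψ.onEdge e).isClassical_Icc (mul_pos hμ (Γ.len_pos e)).le (hΨ.1.1 e)
  have hcH := fun k => (Ψ.onRay k).isClassical_Ici (hΨ.1.2 k)
  have hcE' := fun e => (Φ.onEdge e).isClassical_Icc (mul_pos hμ (Γ.len_pos e)).le (hΦ.1.1 e)
  have hcH' := fun k => (Φ.onRay k).isClassical_Ici (hΦ.1.2 k)
  set G : (ℝ → ℝ) → (ℝ → ℝ) → (ℝ → ℝ) → (ℝ → ℝ) → ℝ → ℝ := fun f f' u u' x =>
    (f x - u x) * (f' x - u' x) with hG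
  set g : (ℝ → ℝ) → (ℝ → ℝ) → (ℝ → ℝ) → (ℝ → ℝ) → ℝ → ℝ := fun f f' u u' x =>
    (f' x - u' x) ^ 2
      + (f x - u x) ^ 2 * (1 - 2 * (f x ^ 2 + f x * u x + u x ^ 2)) with hg
  have hGd : ∀ (f f' u u' : ℝ → ℝ) (x : ℝ), HasDerivAt f (f' x) x →
      HasDerivAt f' (f x - 2 * f x ^ 3) x → HasDerivAt u (u' x) x →
      HasDerivAt u' (u x - 2 * u x ^ 3) x → HasDerivAt (G f f' u u') (g f f' u u' x) x := by
    intro f f' u u' x h1 h2 h3 h4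
    refine ((h1.fun_sub h3).mul (h2.fun_sub h4)).congr_deriv ?_
    simp only [hg]
    ring
  have hg0 : ∀ (f f' u u' : ℝ → ℝ) (x : ℝ), |f x| ≤ 1 / 4 → |u x| ≤ 1 / 4 →
      0 ≤ g f f' u u' x ∧ (g f f' u u' x = 0 → f x = u x) := by
    intro f f' u u' x hf hu
    rw [abs_le] at hf hu
    have h1 : (1 : ℝ) / 2 ≤ 1 - 2 * (f x ^ 2 + f x * u x + u x ^ 2) := by nlinarith
    have h2 : 1 / 2 * (f x - u x) ^ 2 ≤ g f f' u u' x := by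
      simp only [hg]
      nlinarith [sq_nonneg (f' x - u' x), sq_nonneg (f x - u x)]
    refine ⟨le_trans (by positivity) h2, fun h3 => ?_⟩
    rw [h3] at h2
    have : (f x - u x) ^ 2 = 0 := le_antisymm (by linarith) (sq_nonneg _)
    exact sub_eq_zero.1 (pow_eq_zero_iff two_ne_zero |>.1 this)
  have hsum : ∑ e, (G (Ψ.onEdge e).val (Ψ.onEdge e).d1 (Φ.onEdge e).val (Φ.onEdge e).d1
        (μ * Γ.len e)
      - G (Ψ.onEdge e).val (Ψ.onEdge e).d1 (Φ.onEdge e).val (Φ.onEdge e).d1 0)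
      - ∑ k, G (Ψ.onRay k).val (Ψ.onRay k).d1 (Φ.onRay k).val (Φ.onRay k).d1 0 = 0 := by
    have h1 := Ψ.sum_mul_flux fun v => c v - c' v
    have h1' := Φ.sum_mul_flux fun v => c v - c' v
    have h2 : ∀ v, (c v - c' v) * Ψ.flux v = 0 ∧ (c v - c' v) * Φ.flux v = 0 := by
      intro v
      by_cases hv : v ∈ B
      · have h3 : c v = c' v := (hcp ⟨v, hv⟩).trans (hcp' ⟨v, hv⟩).symm
        simp [h3]
      · rw [hflux v hv, hflux' v hv, mul_zero]; exact ⟨rfl, rfl⟩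
    rw [Finset.sum_eq_zero fun v _ => (h2 v).1] at h1
    rw [Finset.sum_eq_zero fun v _ => (h2 v).2] at h1'
    have h3 := (congrArg₂ (fun a b : ℝ => a - b) h1 h1').symm
    refine Eq.trans ?_ (h3.trans (sub_zero 0))
    rw [sub_sub_sub_comm, ← Finset.sum_sub_distrib, ← Finset.sum_sub_distrib]
    congr 1
    · refine Finset.sum_congr rfl fun e _ => ?_
      simp only [hG]
      rw [(hval _).1 e rfl, (hval _).2.1 e rfl, (hval' _).1 e rfl, (hval' _).2.1 e rfl]
      ring
    · refine Finset.sum_congr rfl fun k _ => ?_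
      simp only [hG]
      rw [(hval _).2.2 k rfl, (hval' _).2.2 k rfl]
      ring
  have hz := eq_zero_of_sum_le (Γ := Γ) hμ
    (G := fun e => G (Ψ.onEdge e).val (Ψ.onEdge e).d1 (Φ.onEdge e).val (Φ.onEdge e).d1)
    (g := fun e => g (Ψ.onEdge e).val (Ψ.onEdge e).d1 (Φ.onEdge e).val (Φ.onEdge e).d1)
    (K := fun k => G (Ψ.onRay k).val (Ψ.onRay k).d1 (Φ.onRay k).val (Φ.onRay k).d1)
    (k := fun k => g (Ψ.onRay k).val (Ψ.onRay k).d1 (Φ.onRay k).val (Φ.onRay k).d1)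
    (fun e => ((hcE e).cont_val.sub (hcE' e).cont_val).mul ((hcE e).cont_d1.sub (hcE' e).cont_d1))
    (fun e x hx => by
      rw [← interior_Icc] at hx
      exact hGd _ _ _ _ x ((hcE e).deriv_val x hx) ((hcE e).deriv_d1 x hx)
        ((hcE' e).deriv_val x hx) ((hcE' e).deriv_d1 x hx))
    (fun e x hx => (hg0 _ _ _ _ x (hbΨ.1 e x (Ioo_subset_Icc_self hx))
      (hbΦ.1 e x (Ioo_subset_Icc_self hx))).1)
    (fun k => ((hcH k).cont_val.sub (hcH' k).cont_val).mul ((hcH k).cont_d1.sub (hcH' k).cont_d1))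
    (fun k x hx => by
      rw [← interior_Ici] at hx
      exact hGd _ _ _ _ x ((hcH k).deriv_val x hx) ((hcH k).deriv_d1 x hx)
        ((hcH' k).deriv_val x hx) ((hcH' k).deriv_d1 x hx))
    (fun k x hx => (hg0 _ _ _ _ x (hbΨ.2 k x (Ioi_subset_Ici_self hx))
      (hbΦ.2 k x (Ioi_subset_Ici_self hx))).1)
    (fun k => by
      have ht := (Ψ.onRay k).tendsto_zero (hΨ.1.2 k)
      have ht' := (Φ.onRay k).tendsto_zero (hΦ.1.2 k)
      simpa using (ht.1.sub ht'.1).mul (ht.2.sub ht'.2)) hsum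
  constructor
  · intro e z hz'
    have hpos := mul_pos hμ (Γ.len_pos e)
    have heq : EqOn (Ψ.onEdge e).val (Φ.onEdge e).val (Ioo 0 (μ * Γ.len e)) := fun x hx =>
      (hg0 _ _ _ _ x (hbΨ.1 e x (Ioo_subset_Icc_self hx))
        (hbΦ.1 e x (Ioo_subset_Icc_self hx))).2 (hz.1 e x hx)
    exact heq.of_subset_closure (hcE e).cont_val (hcE' e).cont_val Ioo_subset_Icc_self
      (closure_Ioo hpos.ne).ge hz'
  · intro k z hz'
    have heq : EqOn (Ψ.onRay k).val (Φ.onRay k).val (Ioi 0) := fun x hx =>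
      (hg0 _ _ _ _ x (hbΨ.2 k x (Ioi_subset_Ici_self hx))
        (hbΦ.2 k x (Ioi_subset_Ici_self hx))).2 (hz.2 k x hx)
    exact heq.of_subset_closure (hcH k).cont_val (hcH' k).cont_val Ioi_subset_Ici_self
      (closure_Ioi (0 : ℝ)).ge hz'

end MetricGraph

end

/-! ### The equations for the waves on a graph -/

noncomputable section

open Filter Topology Set

namespace MetricGraph

variable {V E H : Type*}

theorem expMinLen_nonneg (Γ : MetricGraph V E H) (μ : ℝ) : 0 ≤ Γ.expMinLen μ := by
  unfold expMinLen
  split_ifs <;> positivity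

theorem exp_neg_len_le_expMinLen [Finite E] (Γ : MetricGraph V E H) {μ : ℝ} (hμ : 0 < μ) (e : E) :
    Real.exp (-(μ * Γ.len e)) ≤ Γ.expMinLen μ := by
  rw [expMinLen, if_pos ⟨e⟩, Real.exp_le_exp, neg_le_neg_iff]
  exact mul_le_mul_of_nonneg_left (ciInf_le (finite_range _).bddBelow e) hμ.le

theorem tendsto_expMinLen [Finite E] (Γ : MetricGraph V E H) :
    Tendsto Γ.expMinLen atTop (𝓝 0) := by
  by_cases hE : Nonempty E
  · obtain ⟨e₀, he₀⟩ := exists_eq_ciInf_of_finite (f := Γ.len)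
    have hpos : 0 < ⨅ e, Γ.len e := he₀ ▸ Γ.len_pos e₀
    have h : Γ.expMinLen = fun μ => Real.exp (-(μ * ⨅ e, Γ.len e)) := by
      funext μ; rw [expMinLen, if_pos hE]
    rw [h]
    exact Real.tendsto_exp_neg_atTop_nhds_zero.comp (tendsto_id.atTop_mul_const hpos)
  · have h : Γ.expMinLen = fun _ => 0 := by
      funext μ; rw [expMinLen, if_neg hE]
    rw [h]
    exact tendsto_const_nhds

/-- The zero function. -/
def zeroH2 (Γ : MetricGraph V E H) (μ : ℝ) : Γ.H2 μ where
  onEdge _ := ⟨0, 0, 0, MemLp.zero, MemLp.zero, MemLp.zero, by simp, by simp⟩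
  onRay _ := ⟨0, 0, 0, MemLp.zero, MemLp.zero, MemLp.zero, by simp, by simp⟩

/-- The boundary value that is prescribed at a vertex of `B`; zero at the other vertices. -/
def boundaryValue [DecidableEq V] (B : Finset V) (v : V) : EuclideanSpace ℝ B →L[ℝ] ℝ :=
  if h : v ∈ B then EuclideanSpace.proj ⟨v, h⟩ else 0

theorem boundaryValue_of_mem [DecidableEq V] {B : Finset V} {v : V} (h : v ∈ B)
    (p : EuclideanSpace ℝ B) : boundaryValue B v p = p ⟨v, h⟩ := by
  simp [boundaryValue, h]

/-- The vertex to which a wave or a vertex value belongs. -/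
def vertexOf (Γ : MetricGraph V E H) : E ⊕ E ⊕ V → V
  | .inl e => Γ.src e
  | .inr (.inl e) => Γ.tgt e
  | .inr (.inr v) => v

/-- The boundary data as a source term in the equations for the waves. -/
def waveSource [DecidableEq V] (Γ : MetricGraph V E H) (B : Finset V) :
    EuclideanSpace ℝ B →L[ℝ] (E ⊕ E ⊕ V → ℝ) :=
  ContinuousLinearMap.pi fun i => boundaryValue B (Γ.vertexOf i)

theorem norm_waveSource_le [Fintype V] [Fintype E] [DecidableEq V] (Γ : MetricGraph V E H) (B : Finset V)
    (p : EuclideanSpace ℝ B) : ‖Γ.waveSource B p‖ ≤ ‖p‖ := by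
  rw [pi_norm_le_iff_of_nonneg (norm_nonneg _)]
  intro i
  change ‖boundaryValue B (Γ.vertexOf i) p‖ ≤ ‖p‖
  unfold boundaryValue
  split_ifs with h
  · exact PiLp.norm_apply_le p ⟨_, h⟩
  · simp

variable [Fintype E] [Fintype H] [DecidableEq V]

/-- The difference between `(degree v) Ψ(v)` and the flux of a solution `Ψ` at the vertex `v`. The
coordinates `inl e`, `inr (inl e)`, `inr (inr v)` of the vector are the waves that leave the left
and the right end of the edge `e`, and the value at the vertex `v`. -/
def fluxDefect (Γ : MetricGraph V E H) (v : V) (x : ℝ × (E ⊕ E ⊕ V → ℝ)) : ℝ :=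
  (∑ e with Γ.src e = v, 2 * incLeft (x.2 (.inl e), x.2 (.inr (.inl e)), x.1 * Γ.len e)) +
    (∑ e with Γ.tgt e = v, 2 * incRight (x.2 (.inl e), x.2 (.inr (.inl e)), x.1 * Γ.len e)) +
    ∑ h with Γ.base h = v, rayDefect (x.2 (.inr (.inr (Γ.base h))))

/-- Waves on the edges that match the vertex values give a solution on the whole graph. -/
theorem exists_H2_of_waves (Γ : MetricGraph V E H) [Fintype V] {μ : ℝ} (hμ : 0 < μ)
    {y : E ⊕ E ⊕ V → ℝ} (hy : ‖y‖ < 1 / 16)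
    (hleft : ∀ e, y (.inl e) + incLeft (y (.inl e), y (.inr (.inl e)), μ * Γ.len e)
      = y (.inr (.inr (Γ.src e))))
    (hright : ∀ e, y (.inr (.inl e)) + incRight (y (.inl e), y (.inr (.inl e)), μ * Γ.len e)
      = y (.inr (.inr (Γ.tgt e)))) :
    ∃ Ψ : Γ.H2 μ, Ψ.SolvesNLS ∧ (Ψ.Everywhere fun z => |z| ≤ 1 / 4) ∧
      Ψ.norm ≤ Real.sqrt (192 * Fintype.card E + 6 * Fintype.card H) * ‖y‖ ∧
      ∀ v, Ψ.HasValueAt v (y (.inr (.inr v))) ∧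
        Ψ.flux v = Γ.degree v * y (.inr (.inr v)) - Γ.fluxDefect v (μ, y) := by
  choose f hf1 hf2 hf3 hf4 hf5 hf6 hf7 using fun e =>
    exists_H2Fun_edge (mem_edgeDomain hμ (Γ.len_pos e) hy (.inl e) (.inr (.inl e)))
  choose g hg1 hg2 hg3 hg4 hg5 using fun h =>
    exists_H2Fun_ray ((abs_apply_le_norm y (.inr (.inr (Γ.base h)))).trans_lt hy)
  refine ⟨⟨f, g⟩, ⟨fun e => ?_, fun h => ?_⟩, ⟨hf2, hg2⟩, ?_, fun v => ⟨⟨?_, ?_, ?_⟩, ?_⟩⟩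
  · filter_upwards [ae_restrict_mem measurableSet_Icc] with z hz
    rw [sq_abs]
    linear_combination -hf1 e z hz
  · refine Eventually.of_forall fun z => ?_
    rw [sq_abs]
    linear_combination -hg1 h z
  · rw [← Real.sqrt_sq (norm_nonneg y), ← Real.sqrt_mul (by positivity)]
    refine Real.sqrt_le_sqrt ?_
    have h1 : ∑ e, (f e).normSq ≤ ∑ _e : E, 192 * ‖y‖ ^ 2 := Finset.sum_le_sum fun e _ => by
      refine (hf7 e).trans ?_
      have a1 := abs_apply_le_norm y (.inl e)
      have a2 := abs_apply_le_norm y (.inr (.inl e))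
      calc _ ≤ 48 * (‖y‖ + ‖y‖) ^ 2 := by gcongr
        _ = _ := by ring
    have h2 : ∑ h, (g h).normSq ≤ ∑ _h : H, 6 * ‖y‖ ^ 2 := Finset.sum_le_sum fun h _ => by
      refine (hg5 h).trans ?_
      rw [← sq_abs]
      have a1 := abs_apply_le_norm y (.inr (.inr (Γ.base h)))
      gcongr
    rw [Finset.sum_const, Finset.card_univ, nsmul_eq_mul] at h1 h2
    calc _ ≤ _ := add_le_add h1 h2
      _ = _ := by ring
  · rintro e rfl
    exact (hf3 e).trans (hleft e)
  · rintro e rfl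
    exact (hf4 e).trans (hright e)
  · rintro h rfl
    exact hg3 h
  · have h1 : ∑ e with Γ.src e = v, -(f e).d1 0 = ∑ e with Γ.src e = v, (y (.inr (.inr v))
        - 2 * incLeft (y (.inl e), y (.inr (.inl e)), μ * Γ.len e)) :=
      Finset.sum_congr rfl fun e he => by
        rw [hf5 e, ← (Finset.mem_filter.1 he).2, ← hleft e]; ring
    have h2 : ∑ e with Γ.tgt e = v, (f e).d1 (μ * Γ.len e)
        = ∑ e with Γ.tgt e = v, (y (.inr (.inr v))
          - 2 * incRight (y (.inl e), y (.inr (.inl e)), μ * Γ.len e)) :=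
      Finset.sum_congr rfl fun e he => by
        rw [hf6 e, ← (Finset.mem_filter.1 he).2, ← hright e]; ring
    have h3 : ∑ h with Γ.base h = v, -(g h).d1 0 = ∑ h with Γ.base h = v, (y (.inr (.inr v))
        - rayDefect (y (.inr (.inr (Γ.base h))))) :=
      Finset.sum_congr rfl fun h hh => by
        rw [hg4 h, (Finset.mem_filter.1 hh).2]; ring
    rw [Finset.sum_sub_distrib, Finset.sum_const, nsmul_eq_mul] at h1 h2 h3
    simp only [H2.flux, h1, h2, h3, degree, fluxDefect]
    push_cast
    ring

theorem isSmall_fluxDefect [Fintype V] (Γ : MetricGraph V E H) (v : V) :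
    IsSmall Γ.expMinLen (Γ.fluxDefect v) := by
  have he := Γ.expMinLen_nonneg
  have hedge := fun e => isSmall_edge (Γ.len_pos e)
    (fun μ hμ => Γ.exp_neg_len_le_expMinLen hμ e) (.inl e : E ⊕ E ⊕ V) (.inr (.inl e))
  exact ((IsSmall.sum he _ fun e _ => (hedge e).1.const_mul 2).add
    (IsSmall.sum he _ fun e _ => (hedge e).2.const_mul 2)).add
    (IsSmall.sum he _ fun h _ => isSmall_ray he _)

theorem fluxDefect_eq_zero (Γ : MetricGraph V E H) {v : V} (hv : Γ.degree v = 0)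
    (x : ℝ × (E ⊕ E ⊕ V → ℝ)) : Γ.fluxDefect v x = 0 := by
  simp only [degree, add_eq_zero, Finset.card_eq_zero] at hv
  simp only [fluxDefect, hv.1.1, hv.1.2, hv.2, Finset.sum_empty, add_zero]

/-- The part of the vertex value that depends on the waves which arrive at the vertex: outside the
boundary it is determined by the Kirchhoff condition. For a vertex without edges the division by
zero gives zero. -/
def vertexResponse (Γ : MetricGraph V E H) (B : Finset V) (v : V) (x : ℝ × (E ⊕ E ⊕ V → ℝ)) : ℝ :=
  (if v ∈ B then 0 else (Γ.degree v : ℝ)⁻¹) * Γ.fluxDefect v x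

/-- The right-hand sides of the equations for the outgoing waves and the vertex values. -/
def waveResponse (Γ : MetricGraph V E H) (B : Finset V) :
    E ⊕ E ⊕ V → ℝ × (E ⊕ E ⊕ V → ℝ) → ℝ
  | .inl e => fun x => Γ.vertexResponse B (Γ.src e) x
      + -1 * incLeft (x.2 (.inl e), x.2 (.inr (.inl e)), x.1 * Γ.len e)
  | .inr (.inl e) => fun x => Γ.vertexResponse B (Γ.tgt e) x
      + -1 * incRight (x.2 (.inl e), x.2 (.inr (.inl e)), x.1 * Γ.len e)
  | .inr (.inr v) => Γ.vertexResponse B v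

theorem isSmall_waveResponse [Fintype V] (Γ : MetricGraph V E H) (B : Finset V)
    (i : E ⊕ E ⊕ V) : IsSmall Γ.expMinLen (Γ.waveResponse B i) := by
  have hedge := fun e => isSmall_edge (Γ.len_pos e)
    (fun μ hμ => Γ.exp_neg_len_le_expMinLen hμ e) (.inl e : E ⊕ E ⊕ V) (.inr (.inl e))
  have hv : ∀ v, IsSmall Γ.expMinLen (Γ.vertexResponse B v) := fun v =>
    (Γ.isSmall_fluxDefect v).const_mul _
  match i with
  | .inl e => exact (hv _).add ((hedge e).1.const_mul (-1))
  | .inr (.inl e) => exact (hv _).add ((hedge e).2.const_mul (-1))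
  | .inr (.inr v) => exact hv v

/-- Solutions of the equations for the waves are solutions of the boundary value problem. -/
theorem exists_solvesBVP [Fintype V] (Γ : MetricGraph V E H) (B : Finset V)
    {p : EuclideanSpace ℝ B} {μ : ℝ} (hμ : 0 < μ) {y : E ⊕ E ⊕ V → ℝ} (hy : ‖y‖ < 1 / 16)
    (hsys : ∀ i, y i = Γ.waveSource B p i + Γ.waveResponse B i (μ, y)) :
    ∃ Ψ : Γ.H2 μ, Ψ.SolvesBVP B p ∧ (Ψ.Everywhere fun z => |z| ≤ 1 / 4) ∧
      Ψ.norm ≤ Real.sqrt (192 * Fintype.card E + 6 * Fintype.card H) * ‖y‖ ∧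
      ∀ j : B, Ψ.neumann B j = Γ.degree j * p j - Γ.fluxDefect j (μ, y) := by
  have hvert : ∀ v, y (.inr (.inr v)) = boundaryValue B v p + Γ.vertexResponse B v (μ, y) :=
    fun v => hsys (.inr (.inr v))
  have hB : ∀ j : B, y (.inr (.inr (j : V))) = p j := fun j => by
    rw [hvert, boundaryValue_of_mem j.2, vertexResponse, if_pos j.2, zero_mul, add_zero]
  obtain ⟨Ψ, h1, h2, h3, h4⟩ := Γ.exists_H2_of_waves hμ hy
    (fun e => by
      have := hsys (.inl e)
      change y (.inl e) = boundaryValue B (Γ.src e) p + (Γ.vertexResponse B (Γ.src e) (μ, y)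
        + -1 * incLeft (y (.inl e), y (.inr (.inl e)), μ * Γ.len e)) at this
      rw [hvert]; linarith)
    (fun e => by
      have := hsys (.inr (.inl e))
      change y (.inr (.inl e)) = boundaryValue B (Γ.tgt e) p
        + (Γ.vertexResponse B (Γ.tgt e) (μ, y)
        + -1 * incRight (y (.inl e), y (.inr (.inl e)), μ * Γ.len e)) at this
      rw [hvert]; linarith)
  refine ⟨Ψ, ⟨h1, fun v hv => ⟨⟨_, (h4 v).1⟩, ?_⟩, fun j => ?_⟩, h2, h3, fun j => ?_⟩
  · rw [(h4 v).2]
    rcases eq_or_ne (Γ.degree v) 0 with hd | hd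
    · rw [hd, Γ.fluxDefect_eq_zero hd]; simp
    · have hd' : (Γ.degree v : ℝ) ≠ 0 := Nat.cast_ne_zero.2 hd
      have : boundaryValue B v p = 0 := by simp [boundaryValue, hv]
      rw [hvert, this, vertexResponse, if_neg hv, zero_add, mul_inv_cancel_left₀ hd', sub_self]
  · rw [← hB j]; exact (h4 j).1
  · change Ψ.flux j = _
    rw [(h4 j).2, hB j]

end MetricGraph

end

/-! ### Solution of the boundary value problem -/

theorem theorem2p6 {V E H : Type*} [Fintype V] [Fintype E] [Fintype H] [DecidableEq V]
    (Γ : MetricGraph V E H) (B : Finset V) :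
    ∃ C₀ > (0 : ℝ), ∃ p₀ > (0 : ℝ), ∃ μ₀ > (0 : ℝ),
    ∃ Ψ : EuclideanSpace ℝ B → (μ : ℝ) → Γ.H2 μ,
      -- for all small `p` and large `μ`: existence, uniqueness, estimates, positivity
      (∀ (p : EuclideanSpace ℝ B) (μ : ℝ), ‖p‖ < p₀ → μ₀ < μ →
        (Ψ p μ).SolvesBVP B p ∧
        (Ψ p μ).Everywhere (fun y => |y| < 1 / Real.sqrt 2) ∧
        (∀ Ψ' : Γ.H2 μ, Ψ'.SolvesBVP B p → Ψ'.Everywhere (fun y => |y| < 1 / Real.sqrt 2) →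
          Ψ'.Same (Ψ p μ)) ∧
        (Ψ p μ).norm ≤ C₀ * ‖p‖ ∧
        (∀ j : B, |(Ψ p μ).neumann B j - Γ.degree j * p j|
          ≤ C₀ * (‖p‖ * Γ.expMinLen μ + ‖p‖ ^ 3)) ∧
        ((∀ j, 0 ≤ p j) → (Ψ p μ).Everywhere (fun y => 0 ≤ y))) ∧
      -- the Neumann data are `C¹` in `(p, μ)`
      ContDiffOn ℝ 1 (fun x : EuclideanSpace ℝ B × ℝ => (Ψ x.1 x.2).neumann B)
        (Metric.ball 0 p₀ ×ˢ Set.Ioi μ₀) ∧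
      -- the estimates of their partial derivatives
      ∀ (p : EuclideanSpace ℝ B) (μ : ℝ), ‖p‖ < p₀ → μ₀ < μ →
        (∀ i j : B,
          |fderiv ℝ (fun p' => (Ψ p' μ).neumann B j) p (EuclideanSpace.single i 1)
              - (if i = j then (Γ.degree j : ℝ) else 0)|
            ≤ C₀ * (Γ.expMinLen μ + ‖p‖ ^ 2)) ∧
        ∀ j : B, |deriv (fun ν => (Ψ p ν).neumann B j) μ| ≤ C₀ * μ⁻¹ * ‖p‖ := by
  classical
  obtain ⟨p₀, hp₀, hp₀', μ₀, hμ₀, heμ, C, hC, y, hyc, hy⟩ := exists_solution_of_isSmall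
    Γ.expMinLen_nonneg Γ.tendsto_expMinLen (Γ.waveSource B) (Γ.norm_waveSource_le B)
    (Γ.isSmall_waveResponse B)
  choose A hA0 hA using fun j : B => (Γ.isSmall_fluxDefect (j : V)).comp_solution
    (P := EuclideanSpace ℝ B) Γ.expMinLen_nonneg hC
  have hex : ∀ (p : EuclideanSpace ℝ B) (μ : ℝ), ∃ Ψ : Γ.H2 μ, ‖p‖ < p₀ → μ₀ < μ →
      Ψ.SolvesBVP B p ∧ (Ψ.Everywhere fun z => |z| ≤ 1 / 4) ∧
      Ψ.norm ≤ Real.sqrt (192 * Fintype.card E + 6 * Fintype.card H) * ‖y (p, μ)‖ ∧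
      ∀ j : B, Ψ.neumann B j = Γ.degree j * p j - Γ.fluxDefect j (μ, y (p, μ)) := by
    intro p μ
    by_cases h : ‖p‖ < p₀ ∧ μ₀ < μ
    · obtain ⟨hsys, hyn, -⟩ := hy p μ h.1 h.2
      obtain ⟨Ψ, hΨ⟩ := Γ.exists_solvesBVP B (hμ₀.trans h.2) (by linarith) hsys
      exact ⟨Ψ, fun _ _ => hΨ⟩
    · exact ⟨Γ.zeroH2 μ, fun h1 h2 => absurd ⟨h1, h2⟩ h⟩
  choose Ψ hΨ using hex
  set U : Set (EuclideanSpace ℝ B × ℝ) := Metric.ball 0 p₀ ×ˢ Set.Ioi μ₀ with hU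
  have hUo : IsOpen U := Metric.isOpen_ball.prod isOpen_Ioi
  have hmem : ∀ {p : EuclideanSpace ℝ B} {μ : ℝ}, ‖p‖ < p₀ → μ₀ < μ → (p, μ) ∈ U :=
    fun hp hμ => ⟨mem_ball_zero_iff.2 hp, hμ⟩
  have hflux : ∀ j, ∀ x ∈ U, (Ψ x.1 x.2).neumann B j
      = Γ.degree j * x.1 j - Γ.fluxDefect j (x.2, y x) := fun j x hx =>
    (hΨ x.1 x.2 (mem_ball_zero_iff.1 hx.1) hx.2).2.2.2 j
  have hdefect := fun (j : B) (p : EuclideanSpace ℝ B) (μ : ℝ) (hp : ‖p‖ < p₀) (hμ : μ₀ < μ) =>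
    hA j y p μ (hμ₀.trans hμ) (hp.trans hp₀') (heμ μ hμ) (hy p μ hp hμ).2.1
      ((hyc.contDiffAt (hUo.mem_nhds (hmem hp hμ))).differentiableAt one_ne_zero)
      (hy p μ hp hμ).2.2
  set K : ℝ := 2 * Real.sqrt (192 * Fintype.card E + 6 * Fintype.card H) with hK
  set C₀ : ℝ := 1 + K + ∑ j, A j with hC₀
  have hK0 : 0 ≤ K := by positivity
  have hsum0 : 0 ≤ ∑ j, A j := Finset.sum_nonneg fun j _ => hA0 j
  have hAC : ∀ j, A j ≤ C₀ := fun j => by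
    have := Finset.single_le_sum (fun i (_ : i ∈ Finset.univ) => hA0 i) (Finset.mem_univ j)
    linarith
  have hquarter : (1 : ℝ) / 4 < 1 / Real.sqrt 2 := by
    refine one_div_lt_one_div_of_lt (by positivity) ?_
    rw [Real.sqrt_lt' (by norm_num)]; norm_num
  -- the derivative of the Neumann data
  have hderiv : ∀ (j : B) (p : EuclideanSpace ℝ B) (μ : ℝ), ‖p‖ < p₀ → μ₀ < μ →
      ∃ D : EuclideanSpace ℝ B × ℝ →L[ℝ] ℝ,
        HasFDerivAt (fun x : EuclideanSpace ℝ B × ℝ => (Ψ x.1 x.2).neumann B j) D (p, μ) ∧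
        ∀ (p' : EuclideanSpace ℝ B) (μ' : ℝ), |D (p', μ') - Γ.degree j * p' j|
          ≤ C₀ * ((Γ.expMinLen μ + ‖p‖ ^ 2) * ‖p'‖ + μ⁻¹ * ‖p‖ * |μ'|) := by
    intro j p μ hp hμ
    obtain ⟨-, D, hD, hDb⟩ := hdefect j p μ hp hμ
    let Q : EuclideanSpace ℝ B × ℝ →L[ℝ] ℝ :=
      (Γ.degree j : ℝ) • (EuclideanSpace.proj j ∘L .fst ℝ (EuclideanSpace ℝ B) ℝ)
    refine ⟨Q - D, (Q.hasFDerivAt.sub hD).congr_of_eventuallyEq ?_, fun p' μ' => ?_⟩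
    · filter_upwards [hUo.mem_nhds (hmem hp hμ)] with x hx using hflux j x hx
    · have h1 : (Q - D) (p', μ') - Γ.degree j * p' j = -D (p', μ') := by
        simp [Q]
      rw [h1, abs_neg]
      have := Γ.expMinLen_nonneg μ
      have := hμ₀.trans hμ
      exact (hDb p' μ').trans (mul_le_mul_of_nonneg_right (hAC j) (by positivity))
  refine ⟨C₀, by positivity, p₀, hp₀, μ₀, hμ₀, Ψ, fun p μ hp hμ => ?_, ?_, fun p μ hp hμ => ?_⟩
  · have hμ0 := hμ₀.trans hμ
    obtain ⟨hsol, hsmall, hnorm, hneu⟩ := hΨ p μ hp hμ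
    have hlt : (Ψ p μ).Everywhere fun z => |z| < 1 / Real.sqrt 2 :=
      ⟨fun e z hz => (hsmall.1 e z hz).trans_lt hquarter,
        fun h z hz => (hsmall.2 h z hz).trans_lt hquarter⟩
    have hpj : ∀ j, |p j| ≤ ‖p‖ := fun j => PiLp.norm_apply_le p j
    refine ⟨hsol, hlt, fun Φ hΦ hb => ?_, ?_, fun j => ?_, fun hpos => ?_⟩
    · have h1 := hΦ.le_of_boundary_le hμ0 hb (σ := 1) (norm_nonneg p) fun j => by
        rw [one_mul]; exact (le_abs_self _).trans (hpj j)
      have h2 := hΦ.le_of_boundary_le hμ0 hb (σ := -1) (norm_nonneg p) fun j => by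
        rw [neg_one_mul]; exact (neg_le_abs _).trans (hpj j)
      refine hΦ.same_of_small hμ0 hsol ⟨fun e z hz => ?_, fun h z hz => ?_⟩ hsmall
      · have a1 : 1 * (Φ.onEdge e).val z ≤ ‖p‖ := h1.1 e z hz
        have a2 : -1 * (Φ.onEdge e).val z ≤ ‖p‖ := h2.1 e z hz
        exact abs_le.2 ⟨by linarith, by linarith⟩
      · have a1 : 1 * (Φ.onRay h).val z ≤ ‖p‖ := h1.2 h z hz
        have a2 : -1 * (Φ.onRay h).val z ≤ ‖p‖ := h2.2 h z hz
        exact abs_le.2 ⟨by linarith, by linarith⟩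
    · calc (Ψ p μ).norm ≤ _ := hnorm
        _ ≤ Real.sqrt (192 * Fintype.card E + 6 * Fintype.card H) * (2 * ‖p‖) :=
          mul_le_mul_of_nonneg_left (hy p μ hp hμ).2.1 (Real.sqrt_nonneg _)
        _ = K * ‖p‖ := by rw [hK]; ring
        _ ≤ C₀ * ‖p‖ := mul_le_mul_of_nonneg_right (by linarith) (norm_nonneg p)
    · rw [hneu j, sub_sub_cancel_left, abs_neg]
      have := Γ.expMinLen_nonneg μ
      exact (hdefect j p μ hp hμ).1.trans (mul_le_mul_of_nonneg_right (hAC j) (by positivity))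
    · have h := hsol.le_of_boundary_le hμ0 hlt (σ := -1) le_rfl fun j => by
        have := hpos j
        linarith
      refine ⟨fun e z hz => ?_, fun k z hz => ?_⟩
      · have a1 : -1 * ((Ψ p μ).onEdge e).val z ≤ 0 := h.1 e z hz
        change 0 ≤ ((Ψ p μ).onEdge e).val z
        linarith
      · have a1 : -1 * ((Ψ p μ).onRay k).val z ≤ 0 := h.2 k z hz
        change 0 ≤ ((Ψ p μ).onRay k).val z
        linarith
  · rw [contDiffOn_pi]
    intro j
    have h1 : ContDiffOn ℝ 1 (fun x : EuclideanSpace ℝ B × ℝ => Γ.fluxDefect j (x.2, y x)) U := by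
      refine (Γ.isSmall_fluxDefect (j : V)).contDiffOn.comp (contDiffOn_snd.prodMk hyc)
        fun x hx => ⟨hμ₀.trans hx.2, mem_ball_zero_iff.2 ?_⟩
      have h2 := mem_ball_zero_iff.1 hx.1
      have := (hy x.1 x.2 h2 hx.2).2.1
      change ‖y x‖ < _
      linarith
    have h3 : ContDiffOn ℝ 1
        (fun x : EuclideanSpace ℝ B × ℝ => (Γ.degree j : ℝ) * x.1 j) U := by fun_prop
    exact (h3.sub h1).congr (hflux j)
  · have hμ0 := hμ₀.trans hμ
    refine ⟨fun i j => ?_, fun j => ?_⟩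
    · obtain ⟨D, hD, hDb⟩ := hderiv j p μ hp hμ
      have h1 : HasFDerivAt (fun p' => (Ψ p' μ).neumann B j)
          (D ∘L .inl ℝ (EuclideanSpace ℝ B) ℝ) p :=
        HasFDerivAt.comp (g := fun x : EuclideanSpace ℝ B × ℝ => (Ψ x.1 x.2).neumann B j)
          (f := fun p' => (p', μ)) p hD (hasFDerivAt_prodMk_left p μ)
      rw [h1.fderiv]
      have h2 := hDb (EuclideanSpace.single i 1) 0
      simp only [PiLp.norm_single, norm_one, mul_one, abs_zero, mul_zero, add_zero,
        PiLp.single_apply, mul_ite] at h2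
      simpa [eq_comm] using h2
    · obtain ⟨D, hD, hDb⟩ := hderiv j p μ hp hμ
      have h1 : HasDerivAt (fun ν => (Ψ p ν).neumann B j) (D (0, 1)) μ :=
        hD.comp_hasDerivAt μ ((hasDerivAt_const μ p).prodMk (hasDerivAt_id μ))
      rw [h1.deriv]
      have h2 := hDb 0 1
      simpa [mul_assoc] using h2
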